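/- Consider the $\mathcal{PT}$-symmetric Manakov system on $\mathbb{R}$, $$ \begin{aligned} i u_t &= -u_{xx} + \kappa v + i\gamma u - (g_{11}|u|^2 + g_{12}|v|^2)u,\\ i v_t &= -v_{xx} + \kappa u - i\gamma v - (g_{12}|u|^2 + g_{22}|v|^2)v, \end{aligned} $$ with real coefficients $g_{11} = g_{22} = g_{12}$ and $\kappa,\gamma \ge 0$. A global solution is a pair $(u,v) \in C(\mathbb{R}, H^1(\mathbb{R})\times H^1(\mathbb{R}))$ of complex-valued functions that satisfies the two equations in $H^{-1}(\mathbb{R})$ at every $t\in\mathbb{R}$. Put $Q(t) = \|u(t)\|_{L^2}^2 + \|v(t)\|_{L^2}^2$. (1) Let $\gamma < \kappa$. For every global solution there is a constant $Q_{\max} > 0$ such that $\sup_{t\in\mathbb{R}} Q(t) \le Q_{\max}$. Moreover, explicitly in terms of the data at $t=0$, $$ Q(t) \le \frac{\kappa C}{\omega^2} + \sqrt{A_1^2 + A_2^2} \quad\text{for all } t \in \mathbb{R}, $$ where $\omega = \sqrt{\kappa^2-\gamma^2}$, $C = \kappa Q(0) - \gamma S_2(0)$, $A_1 = Q(0) -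 \frac{\kappa C}{\omega^2}$, $A_2 = \frac{\gamma S_3(0)}{\omega}$, $S_2 = i\int_{\mathbb{R}} (\bar u v - u \bar v)\,dx$ and $S_3 = \int_{\mathbb{R}} (|u|^2-|v|^2)\,dx$. (2) Let $\gamma \ge \kappa$ and $\gamma > 0$. Then there exists a global solution such that $\lim_{t\to+\infty} Q(t) = \infty$. -/

import Mathlib

open MeasureTheory Filter Topology
open scoped SchwartzMap ComplexConjugate ENNReal

noncomputable section

/-- The complex Hilbert space `L²(ℝ)`. -/
abbrev L2 : Type := Lp ℂ 2 (volume : Measure ℝ)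

/-- The Sobolev space `H¹(ℝ)` of complex-valued functions, as a subspace: pairs `(f, f')` of `L²` functions such
that `f'` is the distributional derivative of `f`. As a submodule of the `ℓ²`-product of two copies
of `L²(ℝ)` it carries the norm `(‖f‖² + ‖f'‖²)^(1/2)`. -/
def sobolevH1 : Submodule ℂ (WithLp 2 (L2 × L2)) where
  carrier := {p | TemperedDistribution.derivCLM ℂ (Lp.toTemperedDistribution p.fst) =
    Lp.toTemperedDistribution p.snd}
  zero_mem' := by
    simp only [Set.mem_ofPred_eq, ← Lp.toTemperedDistributionCLM_apply, WithLp.zero_fst,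
      WithLp.zero_snd, map_zero]
  add_mem' := by
    intro p q hp hq
    simp only [Set.mem_ofPred_eq, ← Lp.toTemperedDistributionCLM_apply, WithLp.add_fst,
      WithLp.add_snd, map_add] at hp hq ⊢
    rw [hp, hq]
  smul_mem' := by
    intro c p hp
    simp only [Set.mem_ofPred_eq, ← Lp.toTemperedDistributionCLM_apply, WithLp.smul_fst,
      WithLp.smul_snd, map_smul] at hp ⊢
    rw [hp]

/-- The Sobolev space `H¹(ℝ)` as a normed space. -/
abbrev H1 : Type := sobolevH1

/-- The underlying `L²` function of an element of `H¹(ℝ)`. -/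
def H1.fn (f : H1) : L2 := f.val.fst

/-- The weak derivative of an element of `H¹(ℝ)`. -/
def H1.dx (f : H1) : L2 := f.val.snd

/-- `(u, v) ∈ C(ℝ, H¹(ℝ) × H¹(ℝ))` is a global solution of the generalized Manakov system
`i u_t = -u_xx + κ v + i γ u - (g₁₁|u|² + g₁₂|v|²) u`,
`i v_t = -v_xx + κ u - i γ v - (g₁₂|u|² + g₂₂|v|²) v`.
The equations hold at every time in `H⁻¹(ℝ)`, the dual of `H¹(ℝ)`: they are tested against every
`w ∈ H¹(ℝ)`, with `⟨-u_xx, w⟩ = ∫ u_x conj(w_x)`. (Mathlib's `inner ℂ w u` is `∫ u conj(w)`.) -/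
structure IsGlobalSolution (g₁₁ g₁₂ g₂₂ κ γ : ℝ) (u v : ℝ → H1) : Prop where
  continuous_u : Continuous u
  continuous_v : Continuous v
  eq_u : ∀ (t : ℝ) (w : H1),
    HasDerivAt (fun s => Complex.I * inner ℂ w.fn (u s).fn)
      (inner ℂ w.dx (u t).dx + κ * inner ℂ w.fn (v t).fn
        + Complex.I * γ * inner ℂ w.fn (u t).fn
        - ∫ x : ℝ, ((g₁₁ * ‖(u t).fn x‖ ^ 2 + g₁₂ * ‖(v t).fn x‖ ^ 2 : ℝ) : ℂ)
            * (u t).fn x * conj (w.fn x)) t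
  eq_v : ∀ (t : ℝ) (w : H1),
    HasDerivAt (fun s => Complex.I * inner ℂ w.fn (v s).fn)
      (inner ℂ w.dx (v t).dx + κ * inner ℂ w.fn (u t).fn
        - Complex.I * γ * inner ℂ w.fn (v t).fn
        - ∫ x : ℝ, ((g₁₂ * ‖(u t).fn x‖ ^ 2 + g₂₂ * ‖(v t).fn x‖ ^ 2 : ℝ) : ℂ)
            * (v t).fn x * conj (w.fn x)) t

/-- `Q = ‖u‖²_{L²} + ‖v‖²_{L²}`. -/
def totalPower (u v : H1) : ℝ := ‖u.fn‖ ^ 2 + ‖v.fn‖ ^ 2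

/-- The integral Stokes variable `S₂ = i ∫ (ū v - u v̄) dx` (a real number). -/
def stokes2 (u v : H1) : ℝ :=
  (Complex.I * ∫ x : ℝ, (conj (u.fn x) * v.fn x - u.fn x * conj (v.fn x))).re

/-- The integral Stokes variable `S₃ = ∫ (|u|² - |v|²) dx`. -/
def stokes3 (u v : H1) : ℝ := ∫ x : ℝ, (‖u.fn x‖ ^ 2 - ‖v.fn x‖ ^ 2)

/-- The explicit bound `Q_max = κ C / ω² + √(A₁² + A₂²)` computed from the initial data `(u₀, v₀)`,
where `ω = √(κ² - γ²)`, `C = κ Q(0) - γ S₂(0)`, `A₁ = Q(0) - κ C / ω²` and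
`A₂ = Q'(0) / (2ω)` with `Q'(0) = 2 γ S₃(0)`. It is meaningful for `γ < κ`. -/
def Qmax (κ γ : ℝ) (u₀ v₀ : H1) : ℝ :=
  let ω : ℝ := √(κ ^ 2 - γ ^ 2)
  let C : ℝ := κ * totalPower u₀ v₀ - γ * stokes2 u₀ v₀
  let A₁ : ℝ := totalPower u₀ v₀ - κ * C / ω ^ 2
  let A₂ : ℝ := 2 * γ * stokes3 u₀ v₀ / (2 * ω)
  κ * C / ω ^ 2 + √(A₁ ^ 2 + A₂ ^ 2)

end

/-!
If all three coefficients equal `g`, the nonlinearity is multiplication of both components by the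
same real potential `g (|u|² + |v|²)`. It drops out of the evolution of the Stokes variables, which
therefore solve the linear system `Q' = 2γ S₃`, `S₂' = 2κ S₃`, `S₃' = 2γ Q - 2κ S₂`. Hence
`C = κ Q - γ S₂` is conserved and `Q'' = -4ω² (Q - κ C / ω²)`, and for `γ < κ` the conservation of
`(Q - κ C / ω²)² + (γ S₃ / ω)²` yields the bound. As `u` and `v` are differentiable only as curves
in `H⁻¹(ℝ)`, the product rule for these quadratic quantities rests on the Banach–Steinhaus theorem,
which bounds the difference quotients in `H⁻¹(ℝ)`.

For the growing solutions, take `u = a(t) φ`, `v = b(t) φ`, where `(a, b)` solves the linear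
system without dispersion, with `|a|² + |b|² → ∞`, and `φ` solves the scalar equation
`i φ_t = -φ_xx - g (|a|² + |b|²) |φ|² φ`. Mass conservation for `φ` gives
`Q = (|a|² + |b|²) ‖φ(0)‖²`. The scalar equation is solved in the interaction picture, where it is
an ordinary differential equation with a locally Lipschitz field because `H¹(ℝ)` is an algebra; it
is global because the energy, whose time derivative comes only from the coefficient, controls
`‖φ_x‖` through `‖φ‖_∞² ≤ 2 ‖φ‖ ‖φ_x‖` and Grönwall's inequality.
-/

open FourierTransform

theorem inner_eq_integral_mul_conj {α : Type*} [MeasurableSpace α] {μ : Measure α}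
    (f g : Lp ℂ 2 μ) : inner ℂ f g = ∫ x, g x * conj (f x) ∂μ :=
  rfl

theorem integrable_mul_conj {α : Type*} [MeasurableSpace α] {μ : Measure α} (f g : Lp ℂ 2 μ) :
    Integrable (fun x => g x * conj (f x)) μ :=
  L2.integrable_inner (𝕜 := ℂ) f g

theorem integral_norm_mul_norm_le {α 𝕜 E : Type*} [MeasurableSpace α] {μ : Measure α}
    [NormedField 𝕜] [NormedAddCommGroup E] [NormedSpace 𝕜 E] {p q : ℝ≥0∞} [p.HolderConjugate q]
    (f : Lp 𝕜 p μ) (g : Lp E q μ) : ∫ x, ‖f x‖ * ‖g x‖ ∂μ ≤ ‖f‖ * ‖g‖ := by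
  have hprod : (fun x => ‖(f • g : Lp E 1 μ) x‖) =ᵐ[μ] fun x => ‖f x‖ * ‖g x‖ := by
    filter_upwards [Lp.coeFn_lpSMul (r := 1) f g] with x hx
    rw [hx, Pi.smul_apply', norm_smul]
  rw [← integral_congr_ae hprod, ← L1.norm_eq_integral_norm]
  exact Lp.norm_smul_le f g

theorem norm_sq_le_two_mul_integral_of_tendsto_atBot {E : Type*} [NormedAddCommGroup E]
    [InnerProductSpace ℝ E] [CompleteSpace E] {f f' : ℝ → E}
    (hderiv : ∀ y, HasDerivAt f (f' y) y) (hlim : Tendsto f atBot (𝓝 0))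
    (hint : Integrable fun y => ‖f y‖ * ‖f' y‖) (x : ℝ) :
    ‖f x‖ ^ 2 ≤ 2 * ∫ y, ‖f y‖ * ‖f' y‖ := by
  have hbound (y : ℝ) : ‖2 * inner ℝ (f y) (f' y)‖ ≤ 2 * (‖f y‖ * ‖f' y‖) := by
    rw [norm_mul, Real.norm_two]
    gcongr
    exact norm_inner_le_norm _ _
  have hmeas : AEStronglyMeasurable (fun y => 2 * inner ℝ (f y) (f' y)) := by
    have hf : Continuous f := continuous_iff_continuousAt.2 fun y => (hderiv y).continuousAt
    have hf' : f' = deriv f := funext fun y => (hderiv y).deriv.symm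
    exact (hf.aestronglyMeasurable.inner
      (hf' ▸ aestronglyMeasurable_deriv f volume)).const_mul 2
  have hftc : ∫ y in Set.Iic x, 2 * inner ℝ (f y) (f' y) = ‖f x‖ ^ 2 - ‖(0 : E)‖ ^ 2 :=
    integral_Iic_of_hasDerivAt_of_tendsto' (fun y _ => (hderiv y).norm_sq)
      ((hint.const_mul 2).mono' hmeas (.of_forall hbound)).integrableOn (hlim.norm.pow 2)
  calc ‖f x‖ ^ 2 = ∫ y in Set.Iic x, 2 * inner ℝ (f y) (f' y) := by
        rw [hftc, norm_zero, zero_pow two_ne_zero, sub_zero]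
    _ ≤ ∫ y in Set.Iic x, 2 * (‖f y‖ * ‖f' y‖) :=
        (Real.le_norm_self _).trans
          (norm_integral_le_of_norm_le (hint.const_mul 2).integrableOn (.of_forall hbound))
    _ ≤ ∫ y, 2 * (‖f y‖ * ‖f' y‖) :=
        setIntegral_le_integral (hint.const_mul 2) (.of_forall fun y => by positivity)
    _ = 2 * ∫ y, ‖f y‖ * ‖f' y‖ := integral_const_mul _ _

open scoped ContDiff in
theorem ae_eq_of_integral_schwartzMap_smul_eq {E F : Type*} [NormedAddCommGroup E]
    [NormedSpace ℝ E] [FiniteDimensional ℝ E] [MeasurableSpace E] [BorelSpace E]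
    {μ : Measure E} [NormedAddCommGroup F] [NormedSpace ℂ F] [CompleteSpace F] {f f' : E → F}
    (hf : LocallyIntegrable f μ) (hf' : LocallyIntegrable f' μ)
    (h : ∀ g : 𝓢(E, ℂ), ∫ x, g x • f x ∂μ = ∫ x, g x • f' x ∂μ) : f =ᵐ[μ] f' := by
  refine ae_eq_of_integral_contDiff_smul_eq hf hf' fun g hg hgc => ?_
  have hgc' : HasCompactSupport (Complex.ofRealCLM ∘ g) := hgc.comp_left rfl
  have hg' : ContDiff ℝ ∞ (Complex.ofRealCLM ∘ g) := Complex.ofRealCLM.contDiff.comp hg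
  simpa only [HasCompactSupport.toSchwartzMap_toFun, Function.comp_apply,
    Complex.ofRealCLM_apply, Complex.coe_smul] using h (hgc'.toSchwartzMap hg')

/-! ### The Sobolev space `H¹(ℝ)` -/

theorem mem_sobolevH1_iff {p : WithLp 2 (L2 × L2)} :
    p ∈ sobolevH1 ↔ TemperedDistribution.derivCLM ℂ (Lp.toTemperedDistribution p.fst) =
      Lp.toTemperedDistribution p.snd :=
  Iff.rfl

theorem isClosed_sobolevH1 : IsClosed (sobolevH1 : Set (WithLp 2 (L2 × L2))) :=
  isClosed_eq
    ((TemperedDistribution.derivCLM ℂ).continuous.comp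
      ((Lp.toTemperedDistributionCLM ℂ volume 2).continuous.comp
        (WithLp.fstL 2 ℂ L2 L2).continuous))
    ((Lp.toTemperedDistributionCLM ℂ volume 2).continuous.comp
      (WithLp.sndL 2 ℂ L2 L2).continuous)

instance : CompleteSpace H1 := isClosed_sobolevH1.completeSpace_coe

namespace H1

/-- The inclusion `H¹(ℝ) → L²(ℝ)` as a continuous linear map. -/
noncomputable def fnL : H1 →L[ℂ] L2 := (WithLp.fstL 2 ℂ L2 L2).comp sobolevH1.subtypeL

/-- The weak derivative `H¹(ℝ) → L²(ℝ)` as a continuous linear map. -/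
noncomputable def dxL : H1 →L[ℂ] L2 := (WithLp.sndL 2 ℂ L2 L2).comp sobolevH1.subtypeL

theorem continuous_fn : Continuous fn := fnL.continuous

theorem continuous_dx : Continuous dx := dxL.continuous

theorem fn_smul (c : ℂ) (f : H1) : (c • f).fn = c • f.fn := rfl

theorem dx_smul (c : ℂ) (f : H1) : (c • f).dx = c • f.dx := rfl

theorem coeFn_add (f g : H1) : (f + g).fn =ᵐ[volume] fun x => f.fn x + g.fn x :=
  Lp.coeFn_add f.fn g.fn

theorem coeFn_sub (f g : H1) : (f - g).fn =ᵐ[volume] fun x => f.fn x - g.fn x :=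
  Lp.coeFn_sub f.fn g.fn

theorem coeFn_smul (c : ℂ) (f : H1) : (c • f).fn =ᵐ[volume] fun x => c * f.fn x :=
  Lp.coeFn_smul c f.fn

theorem ext_fn_dx {f g : H1} (hfn : f.fn = g.fn) (hdx : f.dx = g.dx) : f = g :=
  Subtype.ext ((WithLp.equiv 2 (L2 × L2)).injective (Prod.ext hfn hdx))

theorem norm_sq_eq (f : H1) : ‖f‖ ^ 2 = ‖f.fn‖ ^ 2 + ‖f.dx‖ ^ 2 :=
  WithLp.prod_norm_sq_eq_of_L2 f.val

theorem norm_fn_le (f : H1) : ‖f.fn‖ ≤ ‖f‖ := WithLp.norm_fst_le L2 f.val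

theorem norm_dx_le (f : H1) : ‖f.dx‖ ≤ ‖f‖ := WithLp.norm_snd_le L2 f.val

theorem norm_le_add (f : H1) : ‖f‖ ≤ ‖f.fn‖ + ‖f.dx‖ := by
  refine abs_le_of_sq_le_sq' ?_ (by positivity) |>.2
  nlinarith [norm_sq_eq f, mul_nonneg (norm_nonneg f.fn) (norm_nonneg f.dx)]

theorem inner_eq (f g : H1) : inner ℂ f g = inner ℂ f.fn g.fn + inner ℂ f.dx g.dx :=
  WithLp.prod_inner_apply f.val g.val

end H1

theorem fourier_derivCLM_toTemperedDistribution_apply (f : L2) (g : 𝓢(ℝ, ℂ)) :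
    𝓕 (TemperedDistribution.derivCLM ℂ (Lp.toTemperedDistribution f)) g =
      ∫ ξ : ℝ, g ξ * ((2 * Real.pi * Complex.I * ξ) * (𝓕 f : L2) ξ) := by
  have hlineDeriv : TemperedDistribution.derivCLM ℂ (Lp.toTemperedDistribution f) =
      LineDeriv.lineDerivOp (1 : ℝ) (Lp.toTemperedDistribution f) := by
    ext φ
    rw [TemperedDistribution.derivCLM_apply_apply, TemperedDistribution.lineDerivOp_apply_apply]
    rfl
  rw [hlineDeriv, TemperedDistribution.fourier_lineDerivOp_eq,
    Lp.fourier_toTemperedDistribution_eq]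
  have hid : (fun x : ℝ => (x : ℂ)).HasTemperateGrowth := by fun_prop
  simp only [RCLike.inner_apply, Real.ringHom_apply, one_mul, smul_apply,
    TemperedDistribution.smulLeftCLM_apply_apply, Lp.toTemperedDistribution_apply, smul_eq_mul]
  rw [← integral_const_mul]
  refine integral_congr_ae (.of_forall fun x => ?_)
  simp only [SchwartzMap.smulLeftCLM_apply_apply hid, smul_eq_mul]
  ring

theorem fourier_toTemperedDistribution_apply (f : L2) (g : 𝓢(ℝ, ℂ)) :
    𝓕 (Lp.toTemperedDistribution f) g = ∫ ξ : ℝ, g ξ * (𝓕 f : L2) ξ := by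
  rw [Lp.fourier_toTemperedDistribution_eq, Lp.toTemperedDistribution_apply]
  rfl

theorem mem_sobolevH1_iff_fourier (p : WithLp 2 (L2 × L2)) :
    p ∈ sobolevH1 ↔
      ∀ᵐ ξ : ℝ, (𝓕 p.snd : L2) ξ = (2 * Real.pi * Complex.I * ξ) * (𝓕 p.fst : L2) ξ := by
  rw [mem_sobolevH1_iff]
  have hloc (f : L2) : LocallyIntegrable f := (Lp.memLp f).locallyIntegrable one_le_two
  have hmul : Continuous fun ξ : ℝ => 2 * Real.pi * Complex.I * (ξ : ℂ) := by fun_prop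
  constructor
  · intro h
    refine ae_eq_of_integral_schwartzMap_smul_eq (hloc _) ((hloc _).continuous_smul hmul)
      fun g => ?_
    simp only [smul_eq_mul]
    rw [← fourier_toTemperedDistribution_apply, ← h, fourier_derivCLM_toTemperedDistribution_apply]
  · intro h
    have hfourier : 𝓕 (TemperedDistribution.derivCLM ℂ (Lp.toTemperedDistribution p.fst)) =
        𝓕 (Lp.toTemperedDistribution p.snd) := by
      ext g
      rw [fourier_derivCLM_toTemperedDistribution_apply, fourier_toTemperedDistribution_apply]
      refine integral_congr_ae ?_
      filter_upwards [h] with ξ hξ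
      rw [hξ]
    exact (fourierEquiv ℂ 𝓢'(ℝ, ℂ)).injective hfourier

theorem mem_sobolevH1_iff_integral (p : WithLp 2 (L2 × L2)) :
    p ∈ sobolevH1 ↔
      ∀ g : 𝓢(ℝ, ℂ), ∫ x : ℝ, deriv g x * p.fst x = - ∫ x : ℝ, g x * p.snd x := by
  have hderiv (g : 𝓢(ℝ, ℂ)) : TemperedDistribution.derivCLM ℂ (Lp.toTemperedDistribution p.fst) g
      = - ∫ x : ℝ, deriv g x * p.fst x := by
    rw [TemperedDistribution.derivCLM_apply_apply, Lp.toTemperedDistribution_apply, ← integral_neg]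
    refine integral_congr_ae (.of_forall fun x => ?_)
    simp
  have hsnd (g : 𝓢(ℝ, ℂ)) : Lp.toTemperedDistribution p.snd g = ∫ x : ℝ, g x * p.snd x :=
    Lp.toTemperedDistribution_apply _ g
  calc p ∈ sobolevH1 ↔ ∀ g : 𝓢(ℝ, ℂ),
        TemperedDistribution.derivCLM ℂ (Lp.toTemperedDistribution p.fst) g =
          Lp.toTemperedDistribution p.snd g :=
        ⟨fun h g => DFunLike.congr_fun h g, fun h => DFunLike.ext _ _ h⟩
    _ ↔ _ := forall_congr' fun g => by rw [hderiv, hsnd, neg_eq_iff_eq_neg]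

namespace H1

theorem integral_deriv_mul (f : H1) (g : 𝓢(ℝ, ℂ)) :
    ∫ x : ℝ, deriv g x * f.fn x = - ∫ x : ℝ, g x * f.dx x :=
  (mem_sobolevH1_iff_integral f.val).1 f.property g

theorem fourier_dx (f : H1) :
    ∀ᵐ ξ : ℝ, (𝓕 f.dx : L2) ξ = (2 * Real.pi * Complex.I * ξ) * (𝓕 f.fn : L2) ξ :=
  (mem_sobolevH1_iff_fourier f.val).1 f.property

theorem dx_eq_of_fn_eq {f g : H1} (h : f.fn = g.fn) : f.dx = g.dx := by
  refine (Lp.fourierTransformₗᵢ ℝ ℂ).injective (Lp.ext ?_)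
  filter_upwards [fourier_dx f, fourier_dx g] with ξ hf hg
  exact hf.trans (h ▸ hg.symm)

theorem ext_ae {f g : H1} (h : f.fn =ᵐ[volume] g.fn) : f = g :=
  ext_fn_dx (Lp.ext h) (dx_eq_of_fn_eq (Lp.ext h))

end H1

/-- Schwartz functions as elements of `H¹(ℝ)`. -/
noncomputable def schwartzH1 : 𝓢(ℝ, ℂ) →ₗ[ℂ] H1 :=
  LinearMap.codRestrict sobolevH1
    ((WithLp.linearEquiv 2 ℂ (L2 × L2)).symm.toLinearMap ∘ₗ
      (SchwartzMap.toLpCLM ℂ ℂ 2 volume).toLinearMap.prod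
        ((SchwartzMap.toLpCLM ℂ ℂ 2 volume).toLinearMap ∘ₗ
          (SchwartzMap.derivCLM ℂ ℂ).toLinearMap))
    fun f => by
      change TemperedDistribution.derivCLM ℂ (Lp.toTemperedDistribution (f.toLp 2 (μ := volume))) =
        Lp.toTemperedDistribution ((SchwartzMap.derivCLM ℂ ℂ f).toLp 2 (μ := volume))
      rw [Lp.toTemperedDistribution_toLp_eq, Lp.toTemperedDistribution_toLp_eq,
        TemperedDistribution.derivCLM_toTemperedDistributionCLM_eq ℂ]

theorem coeFn_schwartzH1_fn (f : 𝓢(ℝ, ℂ)) : (schwartzH1 f).fn =ᵐ[volume] f :=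
  f.coeFn_toLp 2 volume

theorem coeFn_schwartzH1_dx (f : 𝓢(ℝ, ℂ)) : (schwartzH1 f).dx =ᵐ[volume] deriv f := by
  filter_upwards [(SchwartzMap.derivCLM ℂ ℂ f).coeFn_toLp 2 volume] with x hx
  exact hx.trans (SchwartzMap.derivCLM_apply ℂ f x)

/-- Complex conjugation of a Schwartz function. -/
noncomputable def schwartzConj (g : 𝓢(ℝ, ℂ)) : 𝓢(ℝ, ℂ) :=
  g.postcompCLM (𝕜 := ℝ) Complex.conjCLE.toContinuousLinearMap

theorem schwartzConj_apply (g : 𝓢(ℝ, ℂ)) (x : ℝ) : schwartzConj g x = conj (g x) := rfl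

theorem deriv_schwartzConj (g : 𝓢(ℝ, ℂ)) (x : ℝ) :
    deriv (schwartzConj g) x = conj (deriv g x) :=
  HasDerivAt.deriv (f := schwartzConj g) (g.hasDerivAt x).star

namespace H1

theorem toLp_dx_fn_mem_sobolevH1_of_forall_inner_schwartzH1_eq_zero {f : H1}
    (hf : ∀ g : 𝓢(ℝ, ℂ), inner ℂ (schwartzH1 g) f = 0) :
    WithLp.toLp 2 (f.dx, f.fn) ∈ sobolevH1 := by
  rw [mem_sobolevH1_iff_integral]
  intro g
  have hdx : inner ℂ (schwartzH1 (schwartzConj g)).dx f.dx = ∫ x : ℝ, deriv g x * f.dx x := by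
    refine integral_congr_ae ?_
    filter_upwards [coeFn_schwartzH1_dx (schwartzConj g)] with x hx
    rw [RCLike.inner_apply, hx, deriv_schwartzConj, Complex.conj_conj, mul_comm]
  have hfn : inner ℂ (schwartzH1 (schwartzConj g)).fn f.fn = ∫ x : ℝ, g x * f.fn x := by
    refine integral_congr_ae ?_
    filter_upwards [coeFn_schwartzH1_fn (schwartzConj g)] with x hx
    rw [RCLike.inner_apply, hx, schwartzConj_apply, Complex.conj_conj, mul_comm]
  have horth := hf (schwartzConj g)
  rwa [inner_eq, hdx, hfn, add_comm, add_eq_zero_iff_eq_neg] at horth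

theorem eq_zero_of_toLp_dx_fn_mem_sobolevH1 {f : H1}
    (hf : WithLp.toLp 2 (f.dx, f.fn) ∈ sobolevH1) : f = 0 := by
  have hfourier : (𝓕 f.fn : L2) = 0 := by
    refine (Lp.eq_zero_iff_ae_eq_zero).2 ?_
    filter_upwards [(mem_sobolevH1_iff_fourier _).1 hf, fourier_dx f] with ξ hfn hdx
    have hsymbol : ((1 + 4 * Real.pi ^ 2 * ξ ^ 2 : ℝ) : ℂ) * (𝓕 f.fn : L2) ξ = 0 := by
      replace hfn : (𝓕 f.fn : L2) ξ = (2 * Real.pi * Complex.I * ξ) * (𝓕 f.dx : L2) ξ := hfn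
      rw [hdx] at hfn
      push_cast
      linear_combination hfn + 4 * Real.pi ^ 2 * ξ ^ 2 * (𝓕 f.fn : L2) ξ * Complex.I_sq
    have hpos : (1 + 4 * Real.pi ^ 2 * ξ ^ 2 : ℝ) ≠ 0 := by positivity
    exact (mul_eq_zero.1 hsymbol).resolve_left (Complex.ofReal_ne_zero.2 hpos)
  have hfn : f.fn = 0 := by rw [← norm_eq_zero, ← Lp.norm_fourier_eq, hfourier, norm_zero]
  exact ext_fn_dx hfn (dx_eq_of_fn_eq (g := 0) hfn)

theorem denseRange_schwartzH1 : DenseRange schwartzH1 := by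
  have hclosure : schwartzH1.range.topologicalClosure = ⊤ := by
    rw [Submodule.topologicalClosure_eq_top_iff, Submodule.eq_bot_iff]
    intro f hf
    exact eq_zero_of_toLp_dx_fn_mem_sobolevH1
      (toLp_dx_fn_mem_sobolevH1_of_forall_inner_schwartzH1_eq_zero fun g =>
        (Submodule.mem_orthogonal _ _).1 hf _ ⟨g, rfl⟩)
  exact Submodule.dense_iff_topologicalClosure_eq_top.2 hclosure

end H1

theorem norm_sq_le_of_schwartzMap (f : 𝓢(ℝ, ℂ)) (x : ℝ) :
    ‖f x‖ ^ 2 ≤ 2 * ‖(schwartzH1 f).fn‖ * ‖(schwartzH1 f).dx‖ := by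
  have hae : (fun y => ‖(schwartzH1 f).fn y‖ * ‖(schwartzH1 f).dx y‖) =ᵐ[volume]
      fun y => ‖f y‖ * ‖deriv f y‖ := by
    filter_upwards [coeFn_schwartzH1_fn f, coeFn_schwartzH1_dx f] with y hfn hdx
    rw [hfn, hdx]
  have hint : Integrable fun y => ‖f y‖ * ‖deriv f y‖ :=
    ((Lp.memLp (schwartzH1 f).fn).norm.integrable_mul (Lp.memLp (schwartzH1 f).dx).norm).congr hae
  calc ‖f x‖ ^ 2 ≤ 2 * ∫ y, ‖f y‖ * ‖deriv f y‖ :=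
        norm_sq_le_two_mul_integral_of_tendsto_atBot f.hasDerivAt
          (f.tendsto_cocompact.mono_left atBot_le_cocompact) hint x
    _ ≤ 2 * (‖(schwartzH1 f).fn‖ * ‖(schwartzH1 f).dx‖) := by
        rw [← integral_congr_ae hae]
        gcongr
        exact integral_norm_mul_norm_le _ _
    _ = _ := (mul_assoc _ _ _).symm

theorem H1.ae_norm_fn_sq_le (f : H1) : ∀ᵐ x : ℝ, ‖f.fn x‖ ^ 2 ≤ 2 * ‖f.fn‖ * ‖f.dx‖ := by
  obtain ⟨u, hu, hlim⟩ := mem_closure_iff_seq_limit.1 (H1.denseRange_schwartzH1 f)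
  choose s hs using hu
  have hfn : Tendsto (fun n => (u n).fn) atTop (𝓝 f.fn) := (continuous_fn.tendsto f).comp hlim
  have hdx : Tendsto (fun n => (u n).dx) atTop (𝓝 f.dx) := (continuous_dx.tendsto f).comp hlim
  obtain ⟨φ, hφ, hae⟩ := (tendstoInMeasure_of_tendsto_Lp hfn).exists_seq_tendsto_ae
  have hcoe : ∀ᵐ x : ℝ, ∀ n, (u n).fn x = s n x :=
    ae_all_iff.2 fun n => hs n ▸ coeFn_schwartzH1_fn (s n)
  filter_upwards [hae, hcoe] with x hxlim hxcoe
  refine le_of_tendsto_of_tendsto (hxlim.norm.pow 2)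
    (((hfn.norm.const_mul 2).mul hdx.norm).comp hφ.tendsto_atTop) (.of_forall fun n => ?_)
  simp only [Function.comp_apply]
  rw [hxcoe, ← hs]
  exact norm_sq_le_of_schwartzMap (s (φ n)) x

namespace H1

theorem ae_norm_fn_le (f : H1) : ∀ᵐ x : ℝ, ‖f.fn x‖ ≤ ‖f‖ := by
  filter_upwards [ae_norm_fn_sq_le f] with x hx
  refine (sq_le_sq₀ (norm_nonneg _) (norm_nonneg _)).1 (hx.trans ?_)
  rw [norm_sq_eq]
  exact two_mul_le_add_sq _ _

theorem memLp_top (f : H1) : MemLp f.fn ∞ volume :=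
  memLp_top_of_bound (Lp.aestronglyMeasurable _) ‖f‖ (ae_norm_fn_le f)

/-- The Sobolev embedding of `H¹(ℝ)` into `L^∞(ℝ)`. -/
noncomputable def toLinfty : H1 →L[ℂ] Lp ℂ ∞ (volume : Measure ℝ) :=
  LinearMap.mkContinuous
    { toFun := fun f => (memLp_top f).toLp _
      map_add' := fun f g => by
        rw [← MemLp.toLp_add]
        exact MemLp.toLp_congr _ _ (coeFn_add f g)
      map_smul' := fun c f => by
        rw [RingHom.id_apply, ← MemLp.toLp_const_smul]
        exact MemLp.toLp_congr _ _ (coeFn_smul c f) }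
    1 fun f => by
      rw [one_mul, LinearMap.coe_mk, AddHom.coe_mk, Lp.norm_toLp, eLpNorm_exponent_top]
      exact ENNReal.toReal_le_of_le_ofReal (norm_nonneg f)
        (eLpNormEssSup_le_of_ae_bound (ae_norm_fn_le f))

theorem coeFn_toLinfty (f : H1) : toLinfty f =ᵐ[volume] f.fn := (memLp_top f).coeFn_toLp

theorem norm_toLinfty_le (f : H1) : ‖toLinfty f‖ ≤ ‖f‖ :=
  (toLinfty.le_of_opNorm_le (LinearMap.mkContinuous_norm_le _ zero_le_one _) f).trans_eq
    (one_mul _)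

end H1

/-! ### `H¹(ℝ)` as an algebra -/

/-- Multiplication `L^∞(ℝ) × L²(ℝ) → L²(ℝ)`. -/
noncomputable def mulLinfty : Lp ℂ ∞ (volume : Measure ℝ) →L[ℂ] L2 →L[ℂ] L2 :=
  (ContinuousLinearMap.mul ℂ ℂ).holderL volume ∞ 2 2

theorem coeFn_mulLinfty (f : Lp ℂ ∞ (volume : Measure ℝ)) (g : L2) :
    mulLinfty f g =ᵐ[volume] fun x => f x * g x :=
  (ContinuousLinearMap.mul ℂ ℂ).coeFn_holder f g

theorem norm_mulLinfty_le (f : Lp ℂ ∞ (volume : Measure ℝ)) (g : L2) :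
    ‖mulLinfty f g‖ ≤ ‖f‖ * ‖g‖ :=
  calc ‖mulLinfty f g‖ ≤ ‖ContinuousLinearMap.mul ℂ ℂ‖ * ‖f‖ * ‖g‖ :=
        (ContinuousLinearMap.mul ℂ ℂ).norm_holder_apply_apply_le f g
    _ = ‖f‖ * ‖g‖ := by rw [ContinuousLinearMap.opNorm_mul, one_mul]

theorem norm_star_Lp {α R : Type*} {m : MeasurableSpace α} {μ : Measure α} {p : ℝ≥0∞}
    [NormedAddCommGroup R] [StarAddMonoid R] [NormedStarGroup R] (f : Lp R p μ) :
    ‖star f‖ = ‖f‖ := by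
  rw [Lp.norm_def, Lp.norm_def]
  congr 1
  refine eLpNorm_congr_norm_ae ?_
  filter_upwards [Lp.coeFn_star f] with x hx
  rw [hx, Pi.star_apply, _root_.norm_star]

namespace H1

theorem coeFn_mulLinfty_toLinfty (f : H1) (g : L2) :
    mulLinfty (toLinfty f) g =ᵐ[volume] fun x => f.fn x * g x := by
  filter_upwards [coeFn_mulLinfty (toLinfty f) g, coeFn_toLinfty f] with x hmul hf
  rw [hmul, hf]

theorem norm_mulLinfty_toLinfty_le (f : H1) (g : L2) :
    ‖mulLinfty (toLinfty f) g‖ ≤ ‖f‖ * ‖g‖ :=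
  (norm_mulLinfty_le _ _).trans (mul_le_mul_of_nonneg_right (norm_toLinfty_le f) (norm_nonneg _))

/-- The pair `(f g, f g' + g f')`, which is the pointwise product together with the candidate for
its weak derivative. -/
noncomputable def mulPair (f g : H1) : WithLp 2 (L2 × L2) :=
  WithLp.toLp 2 (mulLinfty (toLinfty f) g.fn,
    mulLinfty (toLinfty f) g.dx + mulLinfty (toLinfty g) f.dx)

theorem continuous_mulPair : Continuous fun p : H1 × H1 => mulPair p.1 p.2 := by
  have hmul {g : H1 × H1 → H1} {h : H1 × H1 → L2} (hg : Continuous g) (hh : Continuous h) :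
      Continuous fun p => mulLinfty (toLinfty (g p)) (h p) :=
    (mulLinfty.continuous.comp (toLinfty.continuous.comp hg)).clm_apply hh
  exact (WithLp.prod_continuous_toLp 2 L2 L2).comp
    ((hmul continuous_fst (continuous_fn.comp continuous_snd)).prodMk
      ((hmul continuous_fst (continuous_dx.comp continuous_snd)).add
        (hmul continuous_snd (continuous_dx.comp continuous_fst))))

theorem mulPair_schwartzH1 (a b : 𝓢(ℝ, ℂ)) :
    mulPair (schwartzH1 a) (schwartzH1 b) =
      (schwartzH1 (SchwartzMap.pairing (ContinuousLinearMap.mul ℂ ℂ) a b)).val := by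
  set c := SchwartzMap.pairing (ContinuousLinearMap.mul ℂ ℂ) a b
  refine (WithLp.equiv 2 (L2 × L2)).injective (Prod.ext (Lp.ext ?_) (Lp.ext ?_))
  · filter_upwards [coeFn_mulLinfty_toLinfty (schwartzH1 a) (schwartzH1 b).fn,
      coeFn_schwartzH1_fn a, coeFn_schwartzH1_fn b, coeFn_schwartzH1_fn c] with x hmul ha hb hc
    exact (hmul.trans (by rw [ha, hb]; rfl)).trans hc.symm
  · filter_upwards [coeFn_mulLinfty_toLinfty (schwartzH1 a) (schwartzH1 b).dx,
      coeFn_mulLinfty_toLinfty (schwartzH1 b) (schwartzH1 a).dx,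
      Lp.coeFn_add (mulLinfty (toLinfty (schwartzH1 a)) (schwartzH1 b).dx)
        (mulLinfty (toLinfty (schwartzH1 b)) (schwartzH1 a).dx),
      coeFn_schwartzH1_fn a, coeFn_schwartzH1_fn b, coeFn_schwartzH1_dx a, coeFn_schwartzH1_dx b,
      coeFn_schwartzH1_dx c] with x hab hba hadd ha hb ha' hb' hc'
    have hc : HasDerivAt c (deriv a x * b x + a x * deriv b x) x :=
      (a.hasDerivAt x).mul (b.hasDerivAt x)
    refine (hadd.trans ?_).trans hc'.symm
    rw [Pi.add_apply, hab, hba, ha, hb, ha', hb', hc.deriv]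
    ring

theorem mulPair_mem_sobolevH1 (f g : H1) : mulPair f g ∈ sobolevH1 :=
  denseRange_schwartzH1.induction_on₂ (p := fun f g => mulPair f g ∈ sobolevH1)
    (isClosed_sobolevH1.preimage continuous_mulPair)
    (fun a b => mulPair_schwartzH1 a b ▸ Subtype.property _) f g

/-- The pointwise product of two functions in `H¹(ℝ)`. -/
@[irreducible]
noncomputable def mul (f g : H1) : H1 := ⟨mulPair f g, mulPair_mem_sobolevH1 f g⟩

noncomputable instance : Mul H1 := ⟨mul⟩

theorem fn_mul (f g : H1) : (f * g).fn = mulLinfty (toLinfty f) g.fn := by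
  change (mul f g).fn = _
  rw [mul]
  rfl

theorem dx_mul (f g : H1) :
    (f * g).dx = mulLinfty (toLinfty f) g.dx + mulLinfty (toLinfty g) f.dx := by
  change (mul f g).dx = _
  rw [mul]
  rfl

theorem coeFn_mul (f g : H1) : (f * g).fn =ᵐ[volume] fun x => f.fn x * g.fn x :=
  fn_mul f g ▸ coeFn_mulLinfty_toLinfty f g.fn

theorem norm_mul_le (f g : H1) : ‖f * g‖ ≤ 3 * ‖f‖ * ‖g‖ := by
  have hfn : ‖(f * g).fn‖ ≤ ‖f‖ * ‖g‖ := by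
    rw [fn_mul]
    exact (norm_mulLinfty_toLinfty_le f _).trans (by gcongr; exact norm_fn_le g)
  have hdx : ‖(f * g).dx‖ ≤ ‖f‖ * ‖g‖ + ‖g‖ * ‖f‖ := by
    rw [dx_mul]
    refine (norm_add_le _ _).trans (add_le_add ?_ ?_)
    · exact (norm_mulLinfty_toLinfty_le f _).trans (by gcongr; exact norm_dx_le g)
    · exact (norm_mulLinfty_toLinfty_le g _).trans (by gcongr; exact norm_dx_le f)
  linarith [norm_le_add (f * g)]

instance : ContinuousMul H1 where
  continuous_mul := by
    have heq : (fun p : H1 × H1 => p.1 * p.2) =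
        fun p => ⟨mulPair p.1 p.2, mulPair_mem_sobolevH1 p.1 p.2⟩ :=
      funext fun p => ext_fn_dx (fn_mul _ _) (dx_mul _ _)
    exact heq ▸ continuous_mulPair.subtype_mk _

theorem toLp_star_mem_sobolevH1 (f : H1) :
    WithLp.toLp 2 (star f.fn, star f.dx) ∈ sobolevH1 := by
  rw [mem_sobolevH1_iff_integral]
  intro g
  calc ∫ x : ℝ, deriv g x * (star f.fn : L2) x
      = ∫ x : ℝ, conj (deriv (schwartzConj g) x * f.fn x) := by
        refine integral_congr_ae ?_
        filter_upwards [Lp.coeFn_star f.fn] with x hx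
        rw [hx, deriv_schwartzConj, map_mul, Complex.conj_conj]
        rfl
    _ = - ∫ x : ℝ, conj (schwartzConj g x * f.dx x) := by
        rw [integral_conj, integral_deriv_mul, map_neg, integral_conj]
    _ = - ∫ x : ℝ, g x * (star f.dx : L2) x := by
        congr 1
        refine integral_congr_ae ?_
        filter_upwards [Lp.coeFn_star f.dx] with x hx
        rw [hx, schwartzConj_apply, map_mul, Complex.conj_conj]
        rfl

/-- Complex conjugation of a function in `H¹(ℝ)`. -/
@[irreducible]
noncomputable def conjugate (f : H1) : H1 := ⟨_, toLp_star_mem_sobolevH1 f⟩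

noncomputable instance : Star H1 := ⟨conjugate⟩

theorem fn_star (f : H1) : (star f).fn = star f.fn := by
  change (conjugate f).fn = _
  rw [conjugate]
  rfl

theorem dx_star (f : H1) : (star f).dx = star f.dx := by
  change (conjugate f).dx = _
  rw [conjugate]
  rfl

theorem coeFn_star (f : H1) : (star f).fn =ᵐ[volume] fun x => conj (f.fn x) :=
  fn_star f ▸ Lp.coeFn_star f.fn

theorem star_sub (f g : H1) : star (f - g) = star f - star g := by
  refine ext_ae ?_
  filter_upwards [coeFn_star (f - g), coeFn_star f, coeFn_star g, coeFn_sub (star f) (star g),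
    coeFn_sub f g] with x hfg hf hg hsub hsub'
  rw [hfg, hsub, hf, hg, hsub', map_sub]

theorem norm_star (f : H1) : ‖star f‖ = ‖f‖ := by
  refine (sq_eq_sq₀ (norm_nonneg _) (norm_nonneg _)).1 ?_
  rw [norm_sq_eq, norm_sq_eq, fn_star, dx_star, norm_star_Lp, norm_star_Lp]

instance : ContinuousStar H1 where
  continuous_star := (LipschitzWith.of_dist_le_mul (K := 1) fun f g => by
    rw [dist_eq_norm, dist_eq_norm, ← star_sub, norm_star, NNReal.coe_one, one_mul]).continuous

theorem norm_mul_star_mul_le (f g h : H1) : ‖f * star g * h‖ ≤ 9 * ‖f‖ * ‖g‖ * ‖h‖ :=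
  calc ‖f * star g * h‖ ≤ 3 * ‖f * star g‖ * ‖h‖ := norm_mul_le _ _
    _ ≤ 3 * (3 * ‖f‖ * ‖star g‖) * ‖h‖ := by gcongr; exact norm_mul_le _ _
    _ = 9 * ‖f‖ * ‖g‖ * ‖h‖ := by rw [norm_star]; ring

theorem coeFn_mul_star_mul (f g h : H1) :
    (f * star g * h).fn =ᵐ[volume] fun x => f.fn x * conj (g.fn x) * h.fn x := by
  filter_upwards [coeFn_mul (f * star g) h, coeFn_mul f (star g), coeFn_star g] with x hfgh hfg hg
  rw [hfgh, hfg, hg]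

/-- The cubic nonlinearity `|f|² f`. -/
noncomputable def cubic (f : H1) : H1 := f * star f * f

theorem coeFn_cubic (f : H1) :
    (cubic f).fn =ᵐ[volume] fun x => (‖f.fn x‖ ^ 2 : ℝ) * f.fn x := by
  filter_upwards [coeFn_mul_star_mul f f f] with x hx
  rw [cubic, hx, Complex.mul_conj, Complex.normSq_eq_norm_sq]

theorem continuous_cubic : Continuous cubic := by
  unfold cubic
  fun_prop

theorem cubic_sub_cubic (f g : H1) :
    cubic f - cubic g =
      (f - g) * star f * f + g * star (f - g) * f + g * star g * (f - g) := by
  refine ext_ae ?_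
  filter_upwards [coeFn_sub (cubic f) (cubic g),
    coeFn_add ((f - g) * star f * f + g * star (f - g) * f) (g * star g * (f - g)),
    coeFn_add ((f - g) * star f * f) (g * star (f - g) * f), coeFn_mul_star_mul f f f,
    coeFn_mul_star_mul g g g, coeFn_mul_star_mul (f - g) f f, coeFn_mul_star_mul g (f - g) f,
    coeFn_mul_star_mul g g (f - g), coeFn_sub f g] with x hl hr hr' hf hg h₁ h₂ h₃ hfg
  rw [hl, hr, hr', cubic, cubic, hf, hg, h₁, h₂, h₃, hfg, map_sub]
  ring

theorem norm_cubic_sub_le {R : ℝ} {f g : H1} (hf : ‖f‖ ≤ R) (hg : ‖g‖ ≤ R) :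
    ‖cubic f - cubic g‖ ≤ 27 * R ^ 2 * ‖f - g‖ := by
  have hR : 0 ≤ R := (norm_nonneg f).trans hf
  calc ‖cubic f - cubic g‖
      ≤ ‖(f - g) * star f * f‖ + ‖g * star (f - g) * f‖ + ‖g * star g * (f - g)‖ :=
        cubic_sub_cubic f g ▸ norm_add₃_le
    _ ≤ 9 * ‖f - g‖ * ‖f‖ * ‖f‖ + 9 * ‖g‖ * ‖f - g‖ * ‖f‖ + 9 * ‖g‖ * ‖g‖ * ‖f - g‖ := by
        gcongr <;> exact norm_mul_star_mul_le _ _ _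
    _ ≤ 9 * ‖f - g‖ * R * R + 9 * R * ‖f - g‖ * R + 9 * R * R * ‖f - g‖ := by gcongr
    _ = 27 * R ^ 2 * ‖f - g‖ := by ring

end H1

/-! ### The free Schrödinger group -/

section InnerProductSpace

variable {𝕜 E X : Type*} [RCLike 𝕜] [NormedAddCommGroup E] [InnerProductSpace 𝕜 E]
  [TopologicalSpace X]

theorem continuous_of_forall_continuous_inner_of_norm_eq {u : X → E} {r : ℝ}
    (hu : ∀ w : E, Continuous fun t => inner 𝕜 w (u t)) (hr : ∀ t, ‖u t‖ = r) :
    Continuous u := by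
  refine continuous_iff_continuousAt.2 fun t => tendsto_iff_norm_sub_tendsto_zero.2 ?_
  have hsq : ∀ s, ‖u s - u t‖ ^ 2 = 2 * r ^ 2 - 2 * RCLike.re (inner 𝕜 (u t) (u s)) := fun s => by
    rw [norm_sub_sq (𝕜 := 𝕜), hr, hr, inner_re_symm]
    ring
  have hlim : Tendsto (fun s => ‖u s - u t‖ ^ 2) (𝓝 t) (𝓝 0) := by
    have hcont : Continuous fun s => ‖u s - u t‖ ^ 2 := by
      simp only [hsq]
      exact continuous_const.sub (continuous_const.mul (RCLike.continuous_re.comp (hu (u t))))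
    simpa only [sub_self, norm_zero, zero_pow two_ne_zero] using hcont.tendsto t
  simpa only [Real.sqrt_sq (norm_nonneg _), Real.sqrt_zero] using hlim.sqrt

end InnerProductSpace

/-- The Fourier multiplier `e^{-4π²iξ²t}` of the free Schrödinger group; the factor `4π²` comes
from the normalisation `e^{-2πixξ}` of the Fourier transform. -/
noncomputable def freePhase (t ξ : ℝ) : ℂ :=
  Complex.exp (((-(4 * Real.pi ^ 2 * ξ ^ 2 * t) : ℝ) : ℂ) * Complex.I)

theorem norm_freePhase (t ξ : ℝ) : ‖freePhase t ξ‖ = 1 := Complex.norm_exp_ofReal_mul_I _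

theorem freePhase_zero (ξ : ℝ) : freePhase 0 ξ = 1 := by
  rw [freePhase, mul_zero, neg_zero, Complex.ofReal_zero, zero_mul, Complex.exp_zero]

theorem freePhase_add (s t ξ : ℝ) : freePhase (s + t) ξ = freePhase s ξ * freePhase t ξ := by
  rw [freePhase, freePhase, freePhase, ← Complex.exp_add]
  congr 1
  push_cast
  ring

theorem continuous_freePhase : Continuous fun p : ℝ × ℝ => freePhase p.1 p.2 := by
  unfold freePhase
  fun_prop

theorem aestronglyMeasurable_freePhase (t : ℝ) :
    AEStronglyMeasurable (freePhase t) (volume : Measure ℝ) :=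
  (continuous_freePhase.comp (Continuous.prodMk_right t)).aestronglyMeasurable

theorem memLp_freePhase (t : ℝ) : MemLp (freePhase t) ∞ (volume : Measure ℝ) :=
  memLp_top_of_bound (aestronglyMeasurable_freePhase t) 1
    (Eventually.of_forall fun ξ => (norm_freePhase t ξ).le)

theorem hasDerivAt_freePhase (t ξ : ℝ) :
    HasDerivAt (freePhase · ξ)
      (-Complex.I * (freePhase t ξ * (4 * Real.pi ^ 2 * ξ ^ 2 : ℝ))) t := by
  have hexponent : HasDerivAt
      (fun s : ℝ => ((-(4 * Real.pi ^ 2 * ξ ^ 2 * s) : ℝ) : ℂ) * Complex.I)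
      (((-(4 * Real.pi ^ 2 * ξ ^ 2 * 1) : ℝ) : ℂ) * Complex.I) t :=
    ((((hasDerivAt_id t).const_mul _).neg).ofReal_comp).mul_const _
  refine hexponent.cexp.congr_deriv ?_
  rw [freePhase]
  push_cast
  ring

theorem continuous_integral_freePhase_mul {h : ℝ → ℂ} (hh : Integrable h) :
    Continuous fun t => ∫ ξ : ℝ, freePhase t ξ * h ξ :=
  continuous_of_dominated (bound := fun ξ => ‖h ξ‖)
    (fun t => (aestronglyMeasurable_freePhase t).mul hh.aestronglyMeasurable)
    (fun t => Eventually.of_forall fun ξ => by rw [norm_mul, norm_freePhase, one_mul]) hh.norm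
    (Eventually.of_forall fun ξ =>
      (continuous_freePhase.comp (Continuous.prodMk_left ξ)).mul continuous_const)

theorem hasDerivAt_integral_freePhase_mul {h : ℝ → ℂ} (hh : Integrable h)
    (hh' : Integrable fun ξ : ℝ => ((4 * Real.pi ^ 2 * ξ ^ 2 : ℝ) : ℂ) * h ξ) (t : ℝ) :
    HasDerivAt (fun s => ∫ ξ : ℝ, freePhase s ξ * h ξ)
      (-Complex.I * ∫ ξ : ℝ, freePhase t ξ * (((4 * Real.pi ^ 2 * ξ ^ 2 : ℝ) : ℂ) * h ξ)) t := by
  rw [← integral_const_mul]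
  refine (hasDerivAt_integral_of_dominated_loc_of_deriv_le (s := Set.univ) univ_mem
    (F' := fun s ξ => -Complex.I * (freePhase s ξ * (((4 * Real.pi ^ 2 * ξ ^ 2 : ℝ) : ℂ) * h ξ)))
    (Eventually.of_forall fun s => (aestronglyMeasurable_freePhase s).mul hh.aestronglyMeasurable)
    (hh.bdd_mul (aestronglyMeasurable_freePhase t) (c := 1)
      (Eventually.of_forall fun ξ => (norm_freePhase t ξ).le))
    (((aestronglyMeasurable_freePhase t).mul hh'.aestronglyMeasurable).const_mul _)
    (Eventually.of_forall fun ξ s _ => ?_) hh'.norm (Eventually.of_forall fun ξ s _ => ?_)).2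
  · rw [norm_mul, norm_mul (freePhase s ξ), norm_freePhase, norm_neg, Complex.norm_I,
      one_mul, one_mul]
  · refine ((hasDerivAt_freePhase s ξ).mul_const (h ξ)).congr_deriv ?_
    ring

/-- Multiplication by the unimodular function `freePhase t`, as an isometry of `L²(ℝ)`. -/
noncomputable def mulFreePhase (t : ℝ) : L2 →ₗᵢ[ℂ] L2 where
  toLinearMap := (mulLinfty ((memLp_freePhase t).toLp _)).toLinearMap
  norm_map' f := by
    rw [Lp.norm_def, Lp.norm_def]
    congr 1
    refine eLpNorm_congr_norm_ae ?_
    filter_upwards [coeFn_mulLinfty ((memLp_freePhase t).toLp _) f,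
      (memLp_freePhase t).coeFn_toLp] with ξ hmul hphase
    rw [ContinuousLinearMap.coe_coe, hmul, hphase, norm_mul, norm_freePhase, one_mul]

theorem coeFn_mulFreePhase (t : ℝ) (f : L2) :
    mulFreePhase t f =ᵐ[volume] fun ξ => freePhase t ξ * f ξ := by
  filter_upwards [coeFn_mulLinfty ((memLp_freePhase t).toLp _) f,
    (memLp_freePhase t).coeFn_toLp] with ξ hmul hphase
  rw [← hphase]
  exact hmul

/-- The free Schrödinger group on `L²(ℝ)`. -/
noncomputable def freeL2 (t : ℝ) : L2 →ₗᵢ[ℂ] L2 :=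
  (Lp.fourierTransformₗᵢ ℝ ℂ).symm.toLinearIsometry.comp
    ((mulFreePhase t).comp (Lp.fourierTransformₗᵢ ℝ ℂ).toLinearIsometry)

theorem fourier_freeL2 (t : ℝ) (f : L2) :
    (𝓕 (freeL2 t f) : L2) =ᵐ[volume] fun ξ => freePhase t ξ * (𝓕 f : L2) ξ := by
  have h : (𝓕 (freeL2 t f) : L2) = mulFreePhase t (𝓕 f : L2) :=
    (Lp.fourierTransformₗᵢ ℝ ℂ).apply_symm_apply _
  exact h ▸ coeFn_mulFreePhase t _

theorem eq_of_fourier_ae_eq {f g : L2} (h : (𝓕 f : L2) =ᵐ[volume] (𝓕 g : L2)) : f = g :=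
  (Lp.fourierTransformₗᵢ ℝ ℂ).injective (Lp.ext h)

theorem freeL2_zero (f : L2) : freeL2 0 f = f := by
  refine eq_of_fourier_ae_eq ?_
  filter_upwards [fourier_freeL2 0 f] with ξ hξ
  rw [hξ, freePhase_zero, one_mul]

theorem freeL2_freeL2 (s t : ℝ) (f : L2) : freeL2 s (freeL2 t f) = freeL2 (s + t) f := by
  refine eq_of_fourier_ae_eq ?_
  filter_upwards [fourier_freeL2 s (freeL2 t f), fourier_freeL2 t f, fourier_freeL2 (s + t) f]
    with ξ hs ht hst
  rw [hs, ht, hst, freePhase_add, mul_assoc]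

theorem inner_freeL2 (t : ℝ) (f g : L2) :
    inner ℂ g (freeL2 t f) = ∫ ξ : ℝ, freePhase t ξ * ((𝓕 f : L2) ξ * conj ((𝓕 g : L2) ξ)) := by
  rw [← Lp.inner_fourier_eq, inner_eq_integral_mul_conj]
  refine integral_congr_ae ?_
  filter_upwards [fourier_freeL2 t f] with ξ hξ
  rw [hξ, mul_assoc]

theorem continuous_freeL2 (f : L2) : Continuous fun t => freeL2 t f :=
  continuous_of_forall_continuous_inner_of_norm_eq (𝕜 := ℂ)
    (fun g => by
      simp only [inner_freeL2]
      exact continuous_integral_freePhase_mul (integrable_mul_conj (𝓕 g : L2) (𝓕 f : L2)))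
    fun t => (freeL2 t).norm_map f

namespace H1

theorem toLp_freeL2_mem_sobolevH1 (t : ℝ) (f : H1) :
    (WithLp.toLp 2 (freeL2 t f.fn, freeL2 t f.dx) : WithLp 2 (L2 × L2)) ∈ sobolevH1 := by
  rw [mem_sobolevH1_iff_fourier]
  filter_upwards [fourier_freeL2 t f.fn, fourier_freeL2 t f.dx, fourier_dx f] with ξ hfn hdx hf
  change (𝓕 (freeL2 t f.dx) : L2) ξ = _ * (𝓕 (freeL2 t f.fn) : L2) ξ
  rw [hfn, hdx, hf]
  ring

/-- The free Schrödinger group on `H¹(ℝ)`. -/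
@[irreducible]
noncomputable def free (t : ℝ) : H1 →ₗᵢ[ℂ] H1 where
  toFun f := ⟨_, toLp_freeL2_mem_sobolevH1 t f⟩
  map_add' f g := ext_fn_dx (map_add (freeL2 t) f.fn g.fn) (map_add (freeL2 t) f.dx g.dx)
  map_smul' c f := ext_fn_dx (map_smul (freeL2 t) c f.fn) (map_smul (freeL2 t) c f.dx)
  norm_map' f := by
    refine (sq_eq_sq₀ (norm_nonneg _) (norm_nonneg _)).1 ?_
    rw [norm_sq_eq, norm_sq_eq, ← (freeL2 t).norm_map f.fn, ← (freeL2 t).norm_map f.dx]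
    rfl

theorem fn_free (t : ℝ) (f : H1) : (free t f).fn = freeL2 t f.fn := by
  rw [free]
  rfl

theorem dx_free (t : ℝ) (f : H1) : (free t f).dx = freeL2 t f.dx := by
  rw [free]
  rfl

theorem free_zero (f : H1) : free 0 f = f := by
  refine ext_fn_dx ?_ ?_ <;> simp only [fn_free, dx_free, freeL2_zero]

theorem free_free (s t : ℝ) (f : H1) : free s (free t f) = free (s + t) f := by
  refine ext_fn_dx ?_ ?_ <;> simp only [fn_free, dx_free, freeL2_freeL2]

theorem free_free_neg (t : ℝ) (f : H1) : free t (free (-t) f) = f := by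
  rw [free_free, add_neg_cancel, free_zero]

theorem continuous_free_apply (f : H1) : Continuous fun t => free t f := by
  refine Continuous.subtype_mk (f := fun t => (free t f).val) ?_ fun t => (free t f).property
  have h : ∀ t, (free t f).val = WithLp.toLp 2 (freeL2 t f.fn, freeL2 t f.dx) := fun t =>
    congrArg (WithLp.toLp 2) (Prod.ext (fn_free t f) (dx_free t f))
  simp only [h]
  exact (WithLp.prod_continuous_toLp 2 L2 L2).comp
    ((continuous_freeL2 f.fn).prodMk (continuous_freeL2 f.dx))

theorem continuous_free : Continuous fun p : ℝ × H1 => free p.1 p.2 :=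
  continuous_prod_of_continuous_lipschitzWith' _ 1 (fun t => (free t).lipschitz)
    continuous_free_apply

theorem fourier_dx_mul_conj (f w : H1) :
    (fun ξ : ℝ => (𝓕 f.dx : L2) ξ * conj ((𝓕 w.dx : L2) ξ)) =ᵐ[volume]
      fun ξ => ((4 * Real.pi ^ 2 * ξ ^ 2 : ℝ) : ℂ) *
        ((𝓕 f.fn : L2) ξ * conj ((𝓕 w.fn : L2) ξ)) := by
  filter_upwards [fourier_dx f, fourier_dx w] with ξ hf hw
  rw [hf, hw]
  simp only [map_mul, Complex.conj_I, Complex.conj_ofReal, map_ofNat]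
  push_cast
  linear_combination (-4 * Real.pi ^ 2 * ξ ^ 2 * (𝓕 f.fn : L2) ξ * conj ((𝓕 w.fn : L2) ξ)) *
    Complex.I_sq

theorem hasDerivAt_inner_free (f w : H1) (t : ℝ) :
    HasDerivAt (fun s => inner ℂ w.fn (free s f).fn)
      (-Complex.I * inner ℂ w.dx (free t f).dx) t := by
  simp only [fn_free, dx_free, inner_freeL2]
  have hae := fourier_dx_mul_conj f w
  have hderiv := hasDerivAt_integral_freePhase_mul
    (integrable_mul_conj (𝓕 w.fn : L2) (𝓕 f.fn : L2))
    ((integrable_mul_conj (𝓕 w.dx : L2) (𝓕 f.dx : L2)).congr hae) t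
  refine hderiv.congr_deriv (congrArg _ (integral_congr_ae ?_))
  filter_upwards [hae] with ξ hξ
  rw [hξ]

end H1

/-! ### Differentiation in `H⁻¹(ℝ)` and the Stokes variables -/

section BanachSteinhaus

variable {𝕜 𝕜' X F ι : Type*} [NontriviallyNormedField 𝕜] [NontriviallyNormedField 𝕜']
  {σ : 𝕜 →+* 𝕜'} [RingHomIsometric σ] [NormedAddCommGroup X] [NormedSpace 𝕜 X] [CompleteSpace X]
  [NormedAddCommGroup F] [NormedSpace 𝕜' F]

theorem tendsto_apply_of_forall_tendsto_apply {l : Filter ι} [l.IsCountablyGenerated]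
    {Λ : ι → X →SL[σ] F} {ℓ : X → F} {W : ι → X} {x : X}
    (hΛ : ∀ y, Tendsto (fun i => Λ i y) l (𝓝 (ℓ y))) (hW : Tendsto W l (𝓝 x)) :
    Tendsto (fun i => Λ i (W i)) l (𝓝 (ℓ x)) := by
  refine tendsto_of_seq_tendsto fun i hi => ?_
  obtain ⟨C, hC⟩ := banach_steinhaus (g := fun n => Λ (i n)) fun y => by
    obtain ⟨C, hC⟩ := ((hΛ y).comp hi).norm.bddAbove_range
    exact ⟨C, fun n => hC ⟨n, rfl⟩⟩
  have hdiff : Tendsto (fun n => Λ (i n) (W (i n) - x)) atTop (𝓝 0) := by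
    have hbound : Tendsto (fun n => C * ‖W (i n) - x‖) atTop (𝓝 0) := by
      simpa only [mul_zero, Function.comp_apply] using
        (tendsto_iff_norm_sub_tendsto_zero.1 (hW.comp hi)).const_mul C
    exact squeeze_zero_norm (fun n => (Λ (i n)).le_of_opNorm_le (hC n) _) hbound
  refine (zero_add (ℓ x) ▸ hdiff.add ((hΛ x).comp hi)).congr fun n => ?_
  rw [map_sub, Function.comp_apply, sub_add_cancel, Function.comp_apply]

end BanachSteinhaus

/-- The curve `u` in `H¹(ℝ)` is differentiable at time `t` as a curve in `H⁻¹(ℝ)`, the dual of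
`H¹(ℝ)`: tested against any `w ∈ H¹(ℝ)` its derivative is `ℓ w`. -/
def HasWeakDerivAt (u : ℝ → H1) (ℓ : H1 → ℂ) (t : ℝ) : Prop :=
  ∀ w : H1, HasDerivAt (fun s => inner ℂ w.fn (u s).fn) (ℓ w) t

namespace HasWeakDerivAt

variable {u v : ℝ → H1} {ℓ ℓ' : H1 → ℂ} {t : ℝ}

theorem tendsto_inner_slope (hu : HasWeakDerivAt u ℓ t) {W : ℝ → H1} (hW : ContinuousAt W t) :
    Tendsto (fun s => inner ℂ (W s).fn (slope (fun s => (u s).fn) t s)) (𝓝[≠] t)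
      (𝓝 (ℓ (W t))) := by
  refine tendsto_apply_of_forall_tendsto_apply (ℓ := ℓ)
    (Λ := fun s => ((innerSL ℂ).flip (slope (fun s => (u s).fn) t s)).comp H1.fnL)
    (fun w => ?_) (hW.tendsto.mono_left nhdsWithin_le_nhds)
  refine (hasDerivAt_iff_tendsto_slope.1 (hu w)).congr fun s => ?_
  change _ = inner ℂ w.fn (slope (fun s => (u s).fn) t s)
  rw [slope_def_module, slope_def_module, inner_smul_right_eq_smul, inner_sub_right]

theorem inner (hu : HasWeakDerivAt u ℓ t) (hv : HasWeakDerivAt v ℓ' t) (hvc : ContinuousAt v t) :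
    HasDerivAt (fun s => inner ℂ (v s).fn (u s).fn) (ℓ (v t) + conj (ℓ' (u t))) t := by
  rw [hasDerivAt_iff_tendsto_slope]
  have hv' := (Complex.continuous_conj.tendsto _).comp (hasDerivAt_iff_tendsto_slope.1 (hv (u t)))
  refine ((hu.tendsto_inner_slope hvc).add hv').congr fun s => ?_
  simp only [slope_def_module, Function.comp_apply, Complex.real_smul, map_mul, map_sub,
    Complex.conj_ofReal, inner_conj_symm, inner_smul_right_eq_smul, inner_sub_right]
  ring

theorem norm_sq (hu : HasWeakDerivAt u ℓ t) (huc : ContinuousAt u t) :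
    HasDerivAt (fun s => ‖(u s).fn‖ ^ 2) (2 * (ℓ (u t)).re) t := by
  have hre := Complex.reCLM.hasFDerivAt.comp_hasDerivAt t (hu.inner hu huc)
  refine (hre.congr_deriv ?_).congr_of_eventuallyEq
    (Eventually.of_forall fun s => (inner_self_eq_norm_sq (𝕜 := ℂ) (u s).fn).symm)
  rw [Complex.reCLM_apply, Complex.add_re, Complex.conj_re, two_mul]

end HasWeakDerivAt

/-- The form `∫ V f w̄ dx` of a real potential `V`. -/
noncomputable def potentialForm (V : ℝ → ℝ) (f w : L2) : ℂ :=
  ∫ x : ℝ, (V x : ℂ) * f x * conj (w x)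

theorem conj_potentialForm (V : ℝ → ℝ) (f w : L2) :
    conj (potentialForm V f w) = potentialForm V w f := by
  rw [potentialForm, potentialForm, ← integral_conj]
  refine integral_congr_ae (Eventually.of_forall fun x => ?_)
  simp only [map_mul, Complex.conj_conj, Complex.conj_ofReal]
  ring

theorem potentialForm_self_im (V : ℝ → ℝ) (f : L2) : (potentialForm V f f).im = 0 :=
  Complex.conj_eq_iff_im.1 (conj_potentialForm V f f)

theorem integrable_norm_sq (f : L2) : Integrable fun x : ℝ => ‖f x‖ ^ 2 :=
  (memLp_two_iff_integrable_sq_norm (Lp.aestronglyMeasurable f)).1 (Lp.memLp f)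

theorem integral_norm_sq (f : L2) : ∫ x : ℝ, ‖f x‖ ^ 2 = ‖f‖ ^ 2 := by
  have h : inner ℂ f f = ((∫ x : ℝ, ‖f x‖ ^ 2 : ℝ) : ℂ) := by
    rw [inner_eq_integral_mul_conj, ← integral_complex_ofReal]
    refine integral_congr_ae (Eventually.of_forall fun x => ?_)
    simp only [Complex.mul_conj, Complex.normSq_eq_norm_sq]
  have hre : (inner ℂ f f).re = ‖f‖ ^ 2 := inner_self_eq_norm_sq (𝕜 := ℂ) f
  rwa [h, Complex.ofReal_re] at hre

theorem stokes3_eq (u v : H1) : stokes3 u v = ‖u.fn‖ ^ 2 - ‖v.fn‖ ^ 2 := by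
  rw [stokes3, integral_sub (integrable_norm_sq _) (integrable_norm_sq _), integral_norm_sq,
    integral_norm_sq]

theorem stokes2_eq (u v : H1) : stokes2 u v = 2 * (inner ℂ v.fn u.fn).im := by
  have h : ∫ x : ℝ, (conj (u.fn x) * v.fn x - u.fn x * conj (v.fn x))
      = conj (inner ℂ v.fn u.fn) - inner ℂ v.fn u.fn := by
    rw [inner_conj_symm, inner_eq_integral_mul_conj, inner_eq_integral_mul_conj,
      ← integral_sub (integrable_mul_conj u.fn v.fn)
        (integrable_mul_conj v.fn u.fn)]
    simp only [mul_comm]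
  rw [stokes2, h]
  simp only [Complex.mul_re, Complex.I_re, Complex.I_im, Complex.sub_im, Complex.conj_im,
    Complex.sub_re]
  ring

theorem stokes2_swap (u v : H1) : stokes2 v u = -stokes2 u v := by
  rw [stokes2_eq, stokes2_eq, ← inner_conj_symm, Complex.conj_im]
  ring

namespace IsGlobalSolution

section System

variable {g₁₁ g₁₂ g₂₂ κ γ : ℝ} {u v : ℝ → H1}

theorem swap (h : IsGlobalSolution g₁₁ g₁₂ g₂₂ κ γ u v) :
    IsGlobalSolution g₂₂ g₁₂ g₁₁ κ (-γ) v u where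
  continuous_u := h.continuous_v
  continuous_v := h.continuous_u
  eq_u t w := (h.eq_v t w).congr_deriv (by
    simp only [add_comm, Complex.ofReal_neg, mul_neg, neg_mul, sub_eq_add_neg])
  eq_v t w := (h.eq_u t w).congr_deriv (by
    simp only [add_comm, Complex.ofReal_neg, mul_neg, neg_mul, sub_neg_eq_add])

theorem hasWeakDerivAt (h : IsGlobalSolution g₁₁ g₁₂ g₂₂ κ γ u v) (t : ℝ) :
    HasWeakDerivAt u (fun w => -Complex.I * (inner ℂ w.dx (u t).dx + κ * inner ℂ w.fn (v t).fn
      + Complex.I * γ * inner ℂ w.fn (u t).fn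
      - potentialForm (fun x => g₁₁ * ‖(u t).fn x‖ ^ 2 + g₁₂ * ‖(v t).fn x‖ ^ 2)
        (u t).fn w.fn)) t := fun w => by
  refine ((h.eq_u t w).const_mul (-Complex.I)).congr_of_eventuallyEq
    (Eventually.of_forall fun s => ?_)
  simp only [← mul_assoc, neg_mul, Complex.I_mul_I, neg_neg, one_mul]

theorem hasDerivAt_norm_sq (h : IsGlobalSolution g₁₁ g₁₂ g₂₂ κ γ u v) (t : ℝ) :
    HasDerivAt (fun t => ‖(u t).fn‖ ^ 2)
      (2 * γ * ‖(u t).fn‖ ^ 2 - κ * stokes2 (u t) (v t)) t := by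
  refine ((h.hasWeakDerivAt t).norm_sq h.continuous_u.continuousAt).congr_deriv ?_
  have hself (f : L2) : inner ℂ f f = ((‖f‖ ^ 2 : ℝ) : ℂ) := by
    rw [inner_self_eq_norm_sq_to_K]
    norm_cast
  have hsymm : (inner ℂ (u t).fn (v t).fn).im = -(inner ℂ (v t).fn (u t).fn).im := by
    rw [← inner_conj_symm, Complex.conj_im]
  simp only [stokes2_eq, hself, Complex.mul_re, Complex.mul_im, Complex.neg_re, Complex.neg_im,
    Complex.add_im, Complex.sub_im, Complex.I_re, Complex.I_im, Complex.ofReal_re,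
    Complex.ofReal_im, hsymm, potentialForm_self_im]
  ring

theorem hasDerivAt_totalPower (h : IsGlobalSolution g₁₁ g₁₂ g₂₂ κ γ u v) (t : ℝ) :
    HasDerivAt (fun t => totalPower (u t) (v t)) (2 * γ * stokes3 (u t) (v t)) t :=
  ((h.hasDerivAt_norm_sq t).add (h.swap.hasDerivAt_norm_sq t)).congr_deriv (by
    rw [stokes2_swap, stokes3_eq]
    ring)

theorem hasDerivAt_stokes3 (h : IsGlobalSolution g₁₁ g₁₂ g₂₂ κ γ u v) (t : ℝ) :
    HasDerivAt (fun t => stokes3 (u t) (v t))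
      (2 * γ * totalPower (u t) (v t) - 2 * κ * stokes2 (u t) (v t)) t := by
  simp only [stokes3_eq]
  refine ((h.hasDerivAt_norm_sq t).sub (h.swap.hasDerivAt_norm_sq t)).congr_deriv ?_
  rw [stokes2_swap, totalPower]
  ring

end System

theorem hasDerivAt_stokes2 {g κ γ : ℝ} {u v : ℝ → H1} (h : IsGlobalSolution g g g κ γ u v)
    (t : ℝ) :
    HasDerivAt (fun t => stokes2 (u t) (v t)) (2 * κ * stokes3 (u t) (v t)) t := by
  have him := Complex.imCLM.hasFDerivAt.comp_hasDerivAt t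
    ((h.hasWeakDerivAt t).inner (h.swap.hasWeakDerivAt t) h.continuous_v.continuousAt)
  have hself (f : L2) : inner ℂ f f = ((‖f‖ ^ 2 : ℝ) : ℂ) := by
    rw [inner_self_eq_norm_sq_to_K]
    norm_cast
  simp only [stokes2_eq]
  refine (him.const_mul 2).congr_deriv ?_
  simp only [stokes3_eq, Complex.imCLM_apply, map_mul, map_neg, map_add, map_sub, Complex.conj_I,
    inner_conj_symm, conj_potentialForm, Complex.conj_ofReal, hself,
    add_comm (g * ‖(v t).fn _‖ ^ 2), Complex.mul_re, Complex.mul_im, Complex.neg_re,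
    Complex.neg_im, Complex.ofReal_neg, Complex.add_im, Complex.add_re, Complex.sub_re,
    Complex.sub_im, Complex.I_re, Complex.I_im, Complex.ofReal_re, Complex.ofReal_im]
  ring

end IsGlobalSolution

section StokesSystem

variable {κ γ ω : ℝ} {Q S D : ℝ → ℝ}

theorem apply_eq_apply_zero_of_hasDerivAt_zero {f : ℝ → ℝ} (hf : ∀ t, HasDerivAt f 0 t) (t : ℝ) :
    f t = f 0 :=
  is_const_of_deriv_eq_zero (fun t => (hf t).differentiableAt) (fun t => (hf t).deriv) t 0

theorem stokes_linear_conserved (hQ : ∀ t, HasDerivAt Q (2 * γ * D t) t)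
    (hS : ∀ t, HasDerivAt S (2 * κ * D t) t) (t : ℝ) :
    κ * Q t - γ * S t = κ * Q 0 - γ * S 0 :=
  apply_eq_apply_zero_of_hasDerivAt_zero (f := fun t => κ * Q t - γ * S t) (fun t =>
    (((hQ t).const_mul κ).sub ((hS t).const_mul γ)).congr_deriv (by ring)) t

-- The conserved quantity eliminates `S`, which leaves the harmonic oscillator `Q'' = -4ω²(Q - c)`.
theorem stokes_quadratic_conserved (hω : ω ≠ 0) (hω_sq : ω ^ 2 = κ ^ 2 - γ ^ 2)
    (hQ : ∀ t, HasDerivAt Q (2 * γ * D t) t)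
    (hD : ∀ t, HasDerivAt D (2 * γ * Q t - 2 * κ * S t) t)
    (hS : ∀ t, HasDerivAt S (2 * κ * D t) t) {c : ℝ} (hc : c = κ * (κ * Q 0 - γ * S 0) / ω ^ 2)
    (t : ℝ) :
    (Q t - c) ^ 2 + (γ * D t / ω) ^ 2 = (Q 0 - c) ^ 2 + (γ * D 0 / ω) ^ 2 := by
  refine apply_eq_apply_zero_of_hasDerivAt_zero (f := fun t => (Q t - c) ^ 2 + (γ * D t / ω) ^ 2)
    (fun t => ?_) t
  refine ((((hQ t).sub_const c).pow 2).add
    ((((hD t).const_mul γ).div_const ω).pow 2)).congr_deriv ?_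
  have hcω : c * ω ^ 2 = κ * (κ * Q t - γ * S t) := by
    rw [stokes_linear_conserved hQ hS t, hc]
    field_simp
  have hosc : γ * (2 * γ * Q t - 2 * κ * S t) = -2 * ω ^ 2 * (Q t - c) := by
    linear_combination 2 * Q t * hω_sq - 2 * hcω
  simp only [hosc, Nat.cast_ofNat, Nat.add_one_sub_one, pow_one]
  field_simp
  ring

theorem stokes_le (hω : ω ≠ 0) (hω_sq : ω ^ 2 = κ ^ 2 - γ ^ 2)
    (hQ : ∀ t, HasDerivAt Q (2 * γ * D t) t)
    (hD : ∀ t, HasDerivAt D (2 * γ * Q t - 2 * κ * S t) t)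
    (hS : ∀ t, HasDerivAt S (2 * κ * D t) t) {c : ℝ} (hc : c = κ * (κ * Q 0 - γ * S 0) / ω ^ 2)
    (t : ℝ) :
    Q t ≤ c + √((Q 0 - c) ^ 2 + (2 * γ * D 0 / (2 * ω)) ^ 2) := by
  rw [← sub_le_iff_le_add', mul_assoc, mul_div_mul_left _ _ two_ne_zero,
    ← stokes_quadratic_conserved hω hω_sq hQ hD hS hc t]
  exact Real.le_sqrt_of_sq_le (le_add_of_nonneg_right (sq_nonneg _))

end StokesSystem

theorem IsGlobalSolution.totalPower_le_Qmax {g κ γ : ℝ} (hlt : |γ| < |κ|) {u v : ℝ → H1}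
    (h : IsGlobalSolution g g g κ γ u v) (t : ℝ) :
    totalPower (u t) (v t) ≤ Qmax κ γ (u 0) (v 0) := by
  have hpos : 0 < κ ^ 2 - γ ^ 2 := sub_pos.2 (sq_lt_sq.2 hlt)
  exact stokes_le (S := fun t => stokes2 (u t) (v t)) (Real.sqrt_pos.2 hpos).ne'
    (Real.sq_sqrt hpos.le) h.hasDerivAt_totalPower h.hasDerivAt_stokes3 h.hasDerivAt_stokes2 rfl t

/-! ### Global integral curves from a priori bounds -/

section IntegralCurves

variable {E : Type*} [NormedAddCommGroup E] {f : ℝ → E → E}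

/-- A time-dependent vector field that is continuous in time and Lipschitz on balls, uniformly on
compact time intervals: the Cauchy–Lipschitz hypothesis under which an integral curve can only stop
by leaving every ball. -/
structure IsLipschitzOnBalls (f : ℝ → E → E) : Prop where
  continuous_apply : ∀ x, Continuous fun t => f t x
  exists_lipschitzOnWith : ∀ R T : ℝ, ∃ K : NNReal, ∀ t ∈ Set.Icc (-T) T,
    LipschitzOnWith K (f t) (Metric.closedBall 0 R)

theorem IsLipschitzOnBalls.exists_norm_le (hf : IsLipschitzOnBalls f) (R T : ℝ) :
    ∃ L : NNReal, ∀ t ∈ Set.Icc (-T) T, ∀ x ∈ Metric.closedBall (0 : E) R, ‖f t x‖ ≤ L := by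
  obtain ⟨K, hK⟩ := hf.exists_lipschitzOnWith R T
  obtain ⟨M, hM⟩ := (isCompact_Icc (a := -T) (b := T)).exists_bound_of_continuousOn
    (hf.continuous_apply 0).continuousOn
  refine ⟨(M + K * R).toNNReal, fun t ht x hx => le_trans ?_ (Real.le_coe_toNNReal _)⟩
  have hxR : ‖x‖ ≤ R := mem_closedBall_zero_iff.1 hx
  have hLip := (hK t ht).norm_sub_le hx
    (Metric.mem_closedBall_self ((norm_nonneg x).trans hxR))
  calc ‖f t x‖ ≤ ‖f t 0‖ + ‖f t x - f t 0‖ := norm_le_insert' _ _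
    _ ≤ M + K * ‖x‖ := add_le_add (hM t ht) (by simpa only [sub_zero] using hLip)
    _ ≤ M + K * R := by gcongr

variable [NormedSpace ℝ E] {α β : ℝ → E} {a b c d p δ τ R T : ℝ} {x₀ : E}

theorem exists_glue_isIntegralCurveOn (hα : IsIntegralCurveOn α f (Set.Ioo a b))
    (hβ : IsIntegralCurveOn β f (Set.Ioo c d)) (hp : p ∈ Set.Ioo a b ∩ Set.Ioo c d)
    (h : α p = β p) :
    ∃ η : ℝ → E, Set.EqOn η α (Set.Iic p) ∧ Set.EqOn η β (Set.Ici p) ∧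
      IsIntegralCurveOn η f (Set.Ioo a d) := by
  classical
  have hleft : Set.EqOn ((Set.Iic p).piecewise α β) α (Set.Iic p) := Set.piecewise_eqOn _ _ _
  have hright : Set.EqOn ((Set.Iic p).piecewise α β) β (Set.Ici p) := by
    intro t ht
    rcases (Set.mem_Ici.1 ht).eq_or_lt with rfl | hlt
    · rw [hleft Set.self_mem_Iic, h]
    · exact Set.piecewise_eq_of_notMem _ _ _ (not_le.2 hlt)
  refine ⟨_, hleft, hright, ?_⟩
  have hderiv {η : ℝ → E} {I : Set ℝ} (hη : IsIntegralCurveOn η f I) {t : ℝ} (ht : I ∈ 𝓝 t) :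
      HasDerivAt η (f t (η t)) t := (hη t (mem_of_mem_nhds ht)).hasDerivAt ht
  refine fun t ht => HasDerivAt.hasDerivWithinAt ?_
  rcases lt_trichotomy t p with hlt | rfl | hgt
  · rw [hleft hlt.le]
    exact (hderiv hα (Ioo_mem_nhds ht.1 (hlt.trans hp.1.2))).congr_of_eventuallyEq
      (hleft.eventuallyEq_of_mem (Iic_mem_nhds hlt))
  · rw [← hasDerivWithinAt_univ, ← Set.Iic_union_Ici (a := t)]
    refine HasDerivWithinAt.union ?_ ?_
    · rw [hleft Set.self_mem_Iic]
      exact (hderiv hα (Ioo_mem_nhds hp.1.1 hp.1.2)).hasDerivWithinAt.congr_of_mem hleft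
        Set.self_mem_Iic
    · rw [hright Set.self_mem_Ici]
      exact (hderiv hβ (Ioo_mem_nhds hp.2.1 hp.2.2)).hasDerivWithinAt.congr_of_mem hright
        Set.self_mem_Ici
  · rw [hright hgt.le]
    exact (hderiv hβ (Ioo_mem_nhds (hp.2.1.trans hgt) ht.2)).congr_of_eventuallyEq
      (hright.eventuallyEq_of_mem (Ici_mem_nhds hgt))

theorem exists_extension_isIntegralCurveOn (hα : IsIntegralCurveOn α f (Set.Ioo (-τ) τ))
    (hδ : 0 < δ) (hτ : 0 < τ) (hloc : ∀ t₀ ∈ Set.Ioo (-τ) τ, ∃ β : ℝ → E, β t₀ = α t₀ ∧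
      IsIntegralCurveOn β f (Set.Ioo (t₀ - δ) (t₀ + δ))) :
    ∃ η : ℝ → E, η 0 = α 0 ∧ IsIntegralCurveOn η f (Set.Ioo (-(τ + δ / 2)) (τ + δ / 2)) := by
  obtain ⟨p, hp⟩ : ∃ p, 0 < p ∧ p < τ ∧ τ - δ / 2 ≤ p :=
    ⟨max (τ / 2) (τ - δ / 2), by grind⟩
  obtain ⟨β, hβp, hβ⟩ := hloc p ⟨by linarith, hp.2.1⟩
  obtain ⟨β', hβp', hβ'⟩ := hloc (-p) ⟨by linarith, by linarith⟩
  obtain ⟨η, hηα, -, hη⟩ := exists_glue_isIntegralCurveOn hα hβ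
    ⟨⟨by linarith, hp.2.1⟩, by linarith, by linarith⟩ hβp.symm
  obtain ⟨η', -, hη'η, hη'⟩ := exists_glue_isIntegralCurveOn hβ' hη (p := -p)
    ⟨⟨by linarith, by linarith⟩, by linarith, by linarith⟩
    (hβp'.trans (hηα (Set.mem_Iic.2 (by linarith))).symm)
  refine ⟨η', ?_, hη'.mono (Set.Ioo_subset_Ioo (by linarith) (by linarith))⟩
  rw [hη'η (Set.mem_Ici.2 (by linarith)), hηα (Set.mem_Iic.2 hp.1.le)]

namespace IsLipschitzOnBalls

theorem exists_uniform_existence_time [CompleteSpace E] (hf : IsLipschitzOnBalls f) (R T : ℝ) :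
    ∃ δ > 0, ∀ t₀ ∈ Set.Icc (-T) T, ∀ x₀ ∈ Metric.closedBall (0 : E) R,
      ∃ α : ℝ → E, α t₀ = x₀ ∧ IsIntegralCurveOn α f (Set.Ioo (t₀ - δ) (t₀ + δ)) := by
  obtain ⟨K, hK⟩ := hf.exists_lipschitzOnWith (R + 1) (T + 1)
  obtain ⟨L, hL⟩ := hf.exists_norm_le (R + 1) (T + 1)
  obtain ⟨δ, hδ0, hδ1, hLδ⟩ : ∃ δ : ℝ, 0 < δ ∧ δ ≤ 1 ∧ L * δ ≤ 1 :=
    ⟨1 / (L + 1), by positivity, div_le_one_of_le₀ (by linarith [L.2]) (by positivity), by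
      rw [mul_one_div]; exact div_le_one_of_le₀ (by linarith) (by positivity)⟩
  refine ⟨δ, hδ0, fun t₀ ht₀ x₀ hx₀ => ?_⟩
  have htime : Set.Icc (t₀ - δ) (t₀ + δ) ⊆ Set.Icc (-(T + 1)) (T + 1) :=
    Set.Icc_subset_Icc (by linarith [ht₀.1]) (by linarith [ht₀.2])
  have hball : Metric.closedBall x₀ ((1 : NNReal) : ℝ) ⊆ Metric.closedBall (0 : E) (R + 1) :=
    Metric.closedBall_subset_closedBall'
      (by rw [NNReal.coe_one]; linarith [Metric.mem_closedBall.1 hx₀])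
  have hPL : IsPicardLindelof f (tmin := t₀ - δ) (tmax := t₀ + δ)
      ⟨t₀, by constructor <;> linarith⟩ x₀ 1 0 L K :=
    { lipschitzOnWith := fun t ht => (hK t (htime ht)).mono hball
      continuousOn := fun x _ => (hf.continuous_apply x).continuousOn
      norm_le := fun t ht x hx => hL t (htime ht) x (hball hx)
      mul_max_le := by
        have hmax : max (t₀ + δ - t₀) (t₀ - (t₀ - δ)) = δ := by
          rw [add_sub_cancel_left, sub_sub_cancel, max_self]
        simpa only [hmax, NNReal.coe_one, NNReal.coe_zero, sub_zero] using hLδ }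
  obtain ⟨α, hα₀, hα⟩ := hPL.exists_eq_forall_mem_Icc_hasDerivWithinAt₀
  exact ⟨α, hα₀, fun t ht =>
    (hα t (Set.Ioo_subset_Icc_self ht)).mono Set.Ioo_subset_Icc_self⟩

theorem eqOn_of_isIntegralCurveOn (hf : IsLipschitzOnBalls f)
    (hα : IsIntegralCurveOn α f (Set.Ioo (-τ) τ)) (hβ : IsIntegralCurveOn β f (Set.Ioo (-τ) τ))
    (h : α 0 = β 0) : Set.EqOn α β (Set.Ioo (-τ) τ) := by
  intro t ht
  obtain ⟨s, hts, hsτ⟩ := exists_between (abs_lt.2 ht)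
  have hsub : Set.Icc (-s) s ⊆ Set.Ioo (-τ) τ :=
    Set.Icc_subset_Ioo (neg_lt_neg hsτ) hsτ
  obtain ⟨R₁, hR₁⟩ := isCompact_Icc.exists_bound_of_continuousOn (hα.continuousOn.mono hsub)
  obtain ⟨R₂, hR₂⟩ := isCompact_Icc.exists_bound_of_continuousOn (hβ.continuousOn.mono hsub)
  obtain ⟨K, hK⟩ := hf.exists_lipschitzOnWith (max R₁ R₂) s
  have hderiv {η : ℝ → E} (hη : IsIntegralCurveOn η f (Set.Ioo (-τ) τ)) {r : ℝ}
      (hr : r ∈ Set.Icc (-s) s) : HasDerivAt η (f r (η r)) r :=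
    (hη r (hsub hr)).hasDerivAt (isOpen_Ioo.mem_nhds (hsub hr))
  exact ODE_solution_unique_of_mem_Ioo (s := fun _ => Metric.closedBall 0 (max R₁ R₂))
    (fun r hr => hK r (Set.Ioo_subset_Icc_self hr)) ⟨by linarith [abs_nonneg t], by
      linarith [abs_nonneg t]⟩
    (fun r hr => ⟨hderiv hα (Set.Ioo_subset_Icc_self hr), mem_closedBall_zero_iff.2
      ((hR₁ r (Set.Ioo_subset_Icc_self hr)).trans (le_max_left _ _))⟩)
    (fun r hr => ⟨hderiv hβ (Set.Ioo_subset_Icc_self hr), mem_closedBall_zero_iff.2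
      ((hR₂ r (Set.Ioo_subset_Icc_self hr)).trans (le_max_right _ _))⟩)
    h (abs_lt.1 hts)

theorem exists_isIntegralCurveOn [CompleteSpace E] (hf : IsLipschitzOnBalls f)
    (hbound : ∀ τ ≤ T, ∀ α : ℝ → E, α 0 = x₀ → IsIntegralCurveOn α f (Set.Ioo (-τ) τ) →
      ∀ t ∈ Set.Ioo (-τ) τ, ‖α t‖ ≤ R) (hT : 0 < T) :
    ∃ α : ℝ → E, α 0 = x₀ ∧ IsIntegralCurveOn α f (Set.Ioo (-T) T) := by
  obtain ⟨δ, hδ, hloc⟩ := hf.exists_uniform_existence_time (max R ‖x₀‖) T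
  have hstep (n : ℕ) : ∃ α : ℝ → E, α 0 = x₀ ∧
      IsIntegralCurveOn α f (Set.Ioo (-min T ((n + 1) * (δ / 2))) (min T ((n + 1) * (δ / 2)))) := by
    induction n with
    | zero =>
      obtain ⟨α, hα₀, hα⟩ := hloc 0 ⟨by linarith, hT.le⟩ x₀
        (mem_closedBall_zero_iff.2 (le_max_right _ _))
      exact ⟨α, hα₀, hα.mono (Set.Ioo_subset_Ioo (by grind) (by grind))⟩
    | succ n ih =>
      obtain ⟨α, hα₀, hα⟩ := ih
      set τ := min T ((n + 1) * (δ / 2))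
      have hτT : τ ≤ T := min_le_left _ _
      have hmem (t : ℝ) (ht : t ∈ Set.Ioo (-τ) τ) :
          α t ∈ Metric.closedBall (0 : E) (max R ‖x₀‖) :=
        mem_closedBall_zero_iff.2 ((hbound τ hτT α hα₀ hα t ht).trans (le_max_left _ _))
      obtain ⟨η, hη₀, hη⟩ := exists_extension_isIntegralCurveOn hα hδ (lt_min hT (by positivity))
        fun t ht => hloc t ⟨by linarith [ht.1], by linarith [ht.2]⟩ _ (hmem t ht)
      have hle : min T (((n + 1 : ℕ) + 1) * (δ / 2)) ≤ τ + δ / 2 := by push_cast; grind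
      exact ⟨η, hη₀.trans hα₀, hη.mono (Set.Ioo_subset_Ioo (neg_le_neg hle) hle)⟩
  obtain ⟨n, hn⟩ := exists_nat_ge (T / (δ / 2))
  have hTn : T ≤ (n + 1) * (δ / 2) := by
    rw [div_le_iff₀ (by positivity)] at hn
    linarith
  simpa only [min_eq_left hTn] using hstep n

theorem exists_isIntegralCurve [CompleteSpace E] (hf : IsLipschitzOnBalls f)
    (hbound : ∀ T : ℝ, ∃ R : ℝ, ∀ τ ≤ T, ∀ α : ℝ → E, α 0 = x₀ →
      IsIntegralCurveOn α f (Set.Ioo (-τ) τ) → ∀ t ∈ Set.Ioo (-τ) τ, ‖α t‖ ≤ R) :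
    ∃ α : ℝ → E, α 0 = x₀ ∧ IsIntegralCurve α f := by
  have hex (n : ℕ) : ∃ α : ℝ → E, α 0 = x₀ ∧
      IsIntegralCurveOn α f (Set.Ioo (-((n : ℝ) + 1)) (n + 1)) := by
    obtain ⟨R, hR⟩ := hbound (n + 1)
    exact hf.exists_isIntegralCurveOn hR (by positivity)
  choose A hA₀ hA using hex
  have hcompat {m n : ℕ} {t : ℝ} (hm : |t| < m + 1) (hn : |t| < n + 1) : A m t = A n t := by
    have hmono {k : ℕ} (hk : min (m : ℝ) n + 1 ≤ k + 1) :=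
      (hA k).mono (Set.Ioo_subset_Ioo (neg_le_neg hk) hk)
    exact hf.eqOn_of_isIntegralCurveOn (hmono (by gcongr; exact min_le_left _ _))
      (hmono (by gcongr; exact min_le_right _ _)) ((hA₀ m).trans (hA₀ n).symm)
      (abs_lt.1 (by rw [← min_add_add_right]; exact lt_min hm hn))
  have habs (t : ℝ) : |t| < (⌈|t|⌉₊ : ℝ) + 1 := (Nat.le_ceil _).trans_lt (lt_add_one _)
  refine ⟨fun t => A ⌈|t|⌉₊ t, hA₀ _, fun t => ?_⟩
  have hnhds := Ioo_mem_nhds (abs_lt.1 (habs t)).1 (abs_lt.1 (habs t)).2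
  refine ((hA ⌈|t|⌉₊ t (abs_lt.1 (habs t))).hasDerivAt hnhds).congr_of_eventuallyEq ?_
  filter_upwards [hnhds] with s hs
  exact hcompat (habs s) (abs_lt.2 hs)

end IsLipschitzOnBalls

end IntegralCurves

section Gronwall

variable {E : Type*} [NormedAddCommGroup E] [NormedSpace ℝ E] {F F' : ℝ → E} {τ L : ℝ}

theorem norm_le_mul_exp_of_norm_deriv_le (hF : ∀ t ∈ Set.Ioo (-τ) τ, HasDerivAt F (F' t) t)
    (hF' : ∀ t ∈ Set.Ioo (-τ) τ, ‖F' t‖ ≤ L * ‖F t‖) :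
    ∀ t ∈ Set.Ioo (-τ) τ, ‖F t‖ ≤ ‖F 0‖ * Real.exp (L * |t|) := by
  have hforward {H H' : ℝ → E} (hH : ∀ t ∈ Set.Ioo (-τ) τ, HasDerivAt H (H' t) t)
      (hH' : ∀ t ∈ Set.Ioo (-τ) τ, ‖H' t‖ ≤ L * ‖H t‖) {t : ℝ} (ht : t ∈ Set.Ico 0 τ) :
      ‖H t‖ ≤ ‖H 0‖ * Real.exp (L * t) := by
    have hsub : Set.Icc 0 t ⊆ Set.Ioo (-τ) τ := fun s hs =>
      ⟨(neg_neg_of_pos (ht.1.trans_lt ht.2)).trans_le hs.1, hs.2.trans_lt ht.2⟩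
    have hle := norm_le_gronwallBound_of_norm_deriv_right_le (ε := 0)
      (fun s hs => (hH s (hsub hs)).continuousAt.continuousWithinAt)
      (fun s hs => (hH s (hsub (Set.Ico_subset_Icc_self hs))).hasDerivWithinAt) le_rfl
      (fun s hs => (hH' s (hsub (Set.Ico_subset_Icc_self hs))).trans_eq (add_zero _).symm)
      t ⟨ht.1, le_rfl⟩
    rwa [gronwallBound_ε0, sub_zero] at hle
  intro t ht
  rcases le_total 0 t with hpos | hneg
  · rw [abs_of_nonneg hpos]
    exact hforward hF hF' ⟨hpos, ht.2⟩
  · have hmem {s : ℝ} (hs : s ∈ Set.Ioo (-τ) τ) : -s ∈ Set.Ioo (-τ) τ :=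
      ⟨neg_lt_neg hs.2, neg_lt.1 hs.1⟩
    have hle := hforward (H := fun s => F (-s)) (H' := fun s => -F' (-s))
      (fun s hs => by
        simpa only [Function.comp_def, neg_smul, one_smul] using
          (hF (-s) (hmem hs)).scomp s (hasDerivAt_neg s))
      (fun s hs => by simpa only [norm_neg] using hF' (-s) (hmem hs))
      ⟨neg_nonneg.2 hneg, (hmem ht).2⟩
    simpa only [neg_neg, neg_zero, abs_of_nonpos hneg] using hle

end Gronwall

/-! ### The cubic equation with a time-dependent coefficient -/

namespace H1

theorem inner_fn_cubic (f w : H1) :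
    inner ℂ w.fn (cubic f).fn = potentialForm (fun x => ‖f.fn x‖ ^ 2) f.fn w.fn := by
  rw [inner_eq_integral_mul_conj, potentialForm]
  refine integral_congr_ae ?_
  filter_upwards [coeFn_cubic f] with x hx
  rw [hx]

theorem inner_fn_cubic_self_im (f : H1) : (inner ℂ f.fn (cubic f).fn).im = 0 := by
  rw [inner_fn_cubic, potentialForm_self_im]

theorem norm_fn_cubic_le (f : H1) : ‖(cubic f).fn‖ ≤ 2 * ‖f.fn‖ * ‖f.dx‖ * ‖f.fn‖ := by
  refine Lp.norm_le_mul_norm_of_ae_le_mul ?_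
  filter_upwards [coeFn_cubic f, f.ae_norm_fn_sq_le] with x hcubic hsq
  rw [hcubic, norm_mul, Complex.norm_real, Real.norm_of_nonneg (sq_nonneg _)]
  exact mul_le_mul_of_nonneg_right hsq (norm_nonneg _)

/-- The quartic functional `∫ |f|⁴ dx`. -/
noncomputable def quartic (f : H1) : ℝ := (inner ℂ f.fn (cubic f).fn).re

theorem abs_quartic_le (f : H1) : |quartic f| ≤ 2 * ‖f.fn‖ ^ 3 * ‖f.dx‖ := by
  calc |quartic f| ≤ ‖inner ℂ f.fn (cubic f).fn‖ := Complex.abs_re_le_norm _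
    _ ≤ ‖f.fn‖ * ‖(cubic f).fn‖ := norm_inner_le_norm _ _
    _ ≤ ‖f.fn‖ * (2 * ‖f.fn‖ * ‖f.dx‖ * ‖f.fn‖) := by gcongr; exact norm_fn_cubic_le f
    _ = 2 * ‖f.fn‖ ^ 3 * ‖f.dx‖ := by ring

/-- The divided difference `(|f|² + |g|²)(f + g)` of the quartic functional. -/
noncomputable def quarticDiff (f g : H1) : H1 := f * star f * (f + g) + g * star g * (f + g)

theorem coeFn_quarticDiff (f g : H1) : (quarticDiff f g).fn =ᵐ[volume] fun x =>
    (f.fn x * conj (f.fn x) + g.fn x * conj (g.fn x)) * (f.fn x + g.fn x) := by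
  filter_upwards [coeFn_mul_star_mul f f (f + g), coeFn_mul_star_mul g g (f + g), coeFn_add f g,
    coeFn_add (f * star f * (f + g)) (g * star g * (f + g))] with x hf hg hadd hsum
  rw [quarticDiff, hsum, hf, hg, hadd]
  ring

theorem quarticDiff_self (f : H1) : quarticDiff f f = (4 : ℂ) • cubic f := by
  rw [quarticDiff, cubic, ← two_smul ℂ (f * star f * (f + f))]
  apply ext_ae
  filter_upwards [coeFn_smul 2 (f * star f * (f + f)), coeFn_smul 4 (f * star f * f),
    coeFn_mul_star_mul f f (f + f), coeFn_mul_star_mul f f f, coeFn_add f f]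
    with x htwo hfour hsum hcubic hadd
  rw [htwo, hfour, hsum, hcubic, hadd]
  ring

theorem continuous_quarticDiff (g : H1) : Continuous fun f => quarticDiff f g := by
  unfold quarticDiff
  fun_prop

theorem quartic_sub (f g : H1) :
    quartic f - quartic g = (inner ℂ (quarticDiff f g).fn (f.fn - g.fn)).re := by
  have hinner : inner ℂ (quarticDiff f g).fn (f.fn - g.fn)
      + inner ℂ (f.fn - g.fn) (quarticDiff f g).fn
      = 2 * (inner ℂ f.fn (cubic f).fn - inner ℂ g.fn (cubic g).fn) := by
    simp only [inner_eq_integral_mul_conj, cubic]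
    rw [← integral_add (integrable_mul_conj _ _) (integrable_mul_conj _ _),
      ← integral_sub (integrable_mul_conj _ _) (integrable_mul_conj _ _), ← integral_const_mul]
    refine integral_congr_ae ?_
    filter_upwards [coeFn_quarticDiff f g, Lp.coeFn_sub f.fn g.fn, coeFn_mul_star_mul f f f,
      coeFn_mul_star_mul g g g] with x hdiff hsub hf hg
    rw [hdiff, hsub, Pi.sub_apply, hf, hg]
    simp only [map_mul, map_add, map_sub, Complex.conj_conj]
    ring
  have hre := congrArg Complex.re hinner
  rw [← inner_conj_symm (f.fn - g.fn)] at hre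
  simp only [Complex.add_re, Complex.conj_re, Complex.mul_re, Complex.sub_re, Complex.re_ofNat,
    Complex.im_ofNat, zero_mul, sub_zero] at hre
  rw [quartic, quartic]
  linarith

/-- The vector field whose integral curves `α` give the solutions `t ↦ free t (α t)` of
`i φ_t = -φ_xx - G(t) |φ|² φ`: the cubic term in the interaction picture. -/
noncomputable def nlsField (G : ℝ → ℝ) (t : ℝ) (f : H1) : H1 :=
  (Complex.I * G t) • free (-t) (cubic (free t f))

theorem free_nlsField (G : ℝ → ℝ) (t : ℝ) (f : H1) :
    free t (nlsField G t f) = (Complex.I * G t) • cubic (free t f) := by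
  rw [nlsField, map_smul, free_free_neg]

theorem isLipschitzOnBalls_nlsField {G : ℝ → ℝ} (hG : Continuous G) :
    IsLipschitzOnBalls (nlsField G) where
  continuous_apply f := by
    have hcubic : Continuous fun t => cubic (free t f) :=
      continuous_cubic.comp (continuous_free_apply f)
    exact (continuous_const.mul (Complex.continuous_ofReal.comp hG)).smul
      (continuous_free.comp (continuous_neg.prodMk hcubic))
  exists_lipschitzOnWith R T := by
    obtain ⟨M, hM⟩ :=
      (isCompact_Icc (a := -T) (b := T)).exists_bound_of_continuousOn hG.continuousOn
    refine ⟨⟨|M| * (27 * R ^ 2), by positivity⟩, fun t ht =>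
      LipschitzOnWith.of_dist_le_mul fun f hf g hg => ?_⟩
    rw [mem_closedBall_zero_iff, ← (free t).norm_map] at hf hg
    rw [dist_eq_norm, dist_eq_norm, nlsField, nlsField, ← smul_sub, ← map_sub, norm_smul,
      LinearIsometry.norm_map, norm_mul, Complex.norm_I, one_mul, Complex.norm_real]
    calc ‖G t‖ * ‖cubic (free t f) - cubic (free t g)‖
        ≤ |M| * (27 * R ^ 2 * ‖free t f - free t g‖) :=
          mul_le_mul ((hM t ht).trans (le_abs_self M)) (norm_cubic_sub_le hf hg) (norm_nonneg _)
            (abs_nonneg _)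
      _ = |M| * (27 * R ^ 2) * ‖f - g‖ := by
          rw [← map_sub, LinearIsometry.norm_map]
          ring

/-- The time derivative of a solution `f` of `i f_t = -f_xx - c |f|² f`, as an antilinear functional
of the test function `w`. -/
noncomputable def nlsRate (c : ℝ) (f w : H1) : ℂ :=
  -Complex.I * inner ℂ w.dx f.dx + Complex.I * c * inner ℂ w.fn (cubic f).fn

theorem nlsRate_self_re (c : ℝ) (f : H1) : (nlsRate c f f).re = 0 := by
  have hdx : (inner ℂ f.dx f.dx).im = 0 := inner_self_im (𝕜 := ℂ) f.dx
  simp only [nlsRate, Complex.add_re, Complex.mul_re, Complex.mul_im, Complex.neg_re,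
    Complex.neg_im, Complex.I_re, Complex.I_im, Complex.ofReal_re, Complex.ofReal_im, hdx,
    inner_fn_cubic_self_im]
  ring

theorem nlsRate_cubic_re (c : ℝ) (f : H1) :
    (nlsRate c f (cubic f)).re = (inner ℂ (cubic f).dx f.dx).im := by
  have hfn : (inner ℂ (cubic f).fn (cubic f).fn).im = 0 := inner_self_im (𝕜 := ℂ) (cubic f).fn
  simp only [nlsRate, Complex.add_re, Complex.mul_re, Complex.mul_im, Complex.neg_re,
    Complex.neg_im, Complex.I_re, Complex.I_im, Complex.ofReal_re, Complex.ofReal_im, hfn]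
  ring

theorem nlsRate_smul (c : ℝ) (f w : H1) (z : ℂ) :
    nlsRate c f (z • w) = conj z * nlsRate c f w := by
  simp only [nlsRate, fn_smul, dx_smul, inner_smul_left]
  ring

/-- The energy `½ ∫ |f_x|² dx - (c / 4) ∫ |f|⁴ dx` of `i f_t = -f_xx - c |f|² f`. -/
noncomputable def nlsEnergy (c : ℝ) (f : H1) : ℝ := ‖f.dx‖ ^ 2 / 2 - c / 4 * quartic f

theorem norm_dx_le_nlsEnergy_add {c M : ℝ} (hc : |c| ≤ M) (f : H1) :
    ‖f.dx‖ ≤ nlsEnergy c f + ((M * ‖f.fn‖ ^ 3 / 2) ^ 2 + 1) := by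
  have hquartic : c / 4 * quartic f ≤ M * ‖f.fn‖ ^ 3 / 2 * ‖f.dx‖ := by
    calc c / 4 * quartic f ≤ |c| / 4 * |quartic f| := by
          refine (le_abs_self _).trans_eq ?_
          rw [abs_mul, abs_div, abs_of_pos (four_pos : (0 : ℝ) < 4)]
      _ ≤ M / 4 * (2 * ‖f.fn‖ ^ 3 * ‖f.dx‖) := by
          have hM : 0 ≤ M := (abs_nonneg c).trans hc
          gcongr
          exact abs_quartic_le f
      _ = M * ‖f.fn‖ ^ 3 / 2 * ‖f.dx‖ := by ring
  rw [nlsEnergy]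
  linarith [sq_nonneg (‖f.dx‖ / 2 - M * ‖f.fn‖ ^ 3 / 2), sq_nonneg (‖f.dx‖ / 2 - 1)]

end H1

theorem HasWeakDerivAt.quartic {u : ℝ → H1} {ℓ : H1 → ℂ} {t : ℝ} (hu : HasWeakDerivAt u ℓ t)
    (huc : ContinuousAt u t) :
    HasDerivAt (fun s => (u s).quartic) (ℓ ((4 : ℂ) • (u t).cubic)).re t := by
  have hslope := (Complex.continuous_re.tendsto _).comp (hu.tendsto_inner_slope
    ((H1.continuous_quarticDiff (u t)).continuousAt.comp huc))
  rw [hasDerivAt_iff_tendsto_slope, ← H1.quarticDiff_self]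
  refine hslope.congr fun s => ?_
  rw [Function.comp_apply, Function.comp_apply, slope_def_module, slope_def_module,
    inner_smul_right_eq_smul, Complex.smul_re, H1.quartic_sub]

theorem hasDerivAt_norm_sq_of_inner {𝕜 E : Type*} [RCLike 𝕜] [NormedAddCommGroup E]
    [InnerProductSpace 𝕜 E] [NormedSpace ℝ E] {f : ℝ → E} {f' : E} {t : ℝ}
    (hf : HasDerivAt f f' t) :
    HasDerivAt (fun s => ‖f s‖ ^ 2) (2 * RCLike.re (inner 𝕜 f' (f t))) t := by
  have hre := RCLike.reCLM.hasFDerivAt.comp_hasDerivAt t (hf.inner 𝕜 hf)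
  refine (hre.congr_deriv ?_).congr_of_eventuallyEq
    (Eventually.of_forall fun s => (inner_self_eq_norm_sq (𝕜 := 𝕜) (f s)).symm)
  change RCLike.re (inner 𝕜 (f t) f' + inner 𝕜 f' (f t)) = _
  rw [map_add, inner_re_symm (f t), two_mul]

namespace H1

section Trajectory

variable {G : ℝ → ℝ} {α : ℝ → H1} {t : ℝ}

theorem continuousAt_free_trajectory (hα : ContinuousAt α t) :
    ContinuousAt (fun s => free s (α s)) t :=
  continuous_free.continuousAt.comp (f := fun s => (s, α s)) (continuousAt_id.prodMk hα)

theorem hasWeakDerivAt_free_trajectory (hα : HasDerivAt α (nlsField G t (α t)) t) :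
    HasWeakDerivAt (fun s => free s (α s)) (nlsRate (G t) (free t (α t))) t := by
  intro w
  have hfree := hasDerivAt_iff_tendsto_slope.1 (hasDerivAt_inner_free (α t) w t)
  have hslope : Tendsto (fun s => inner ℂ w.fn (free s (slope α t s)).fn) (𝓝[≠] t)
      (𝓝 (inner ℂ w.fn (free t (nlsField G t (α t))).fn)) := by
    have hpair : Tendsto (fun s => (s, slope α t s)) (𝓝[≠] t) (𝓝 (t, nlsField G t (α t))) :=
      (tendsto_id.mono_left nhdsWithin_le_nhds).prodMk_nhds (hasDerivAt_iff_tendsto_slope.1 hα)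
    exact tendsto_const_nhds.inner
      (((continuous_fn.comp continuous_free).tendsto (t, nlsField G t (α t))).comp hpair)
  rw [free_nlsField, fn_smul, inner_smul_right] at hslope
  refine hasDerivAt_iff_tendsto_slope.2 ((hfree.add hslope).congr fun s => ?_)
  have hsplit : free s (slope α t s) = (((s - t)⁻¹ : ℝ) : ℂ) • (free s (α s) - free s (α t)) := by
    rw [← map_sub, ← map_smul, slope_def_module]
    rfl
  have hsub : (free s (α s) - free s (α t)).fn = (free s (α s)).fn - (free s (α t)).fn := rfl
  rw [hsplit, fn_smul, hsub, inner_smul_right, inner_sub_right, slope_def_module,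
    slope_def_module, Complex.real_smul, Complex.real_smul]
  ring

theorem hasDerivAt_norm_fn_sq (hα : HasDerivAt α (nlsField G t (α t)) t) :
    HasDerivAt (fun s => ‖(α s).fn‖ ^ 2) 0 t := by
  have hmass := (hasWeakDerivAt_free_trajectory hα).norm_sq
    (continuousAt_free_trajectory hα.continuousAt)
  rw [nlsRate_self_re, mul_zero] at hmass
  simpa only [fn_free, LinearIsometry.norm_map] using hmass

theorem hasDerivAt_norm_dx_sq (hα : HasDerivAt α (nlsField G t (α t)) t) :
    HasDerivAt (fun s => ‖(α s).dx‖ ^ 2)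
      (2 * G t * (inner ℂ (cubic (free t (α t))).dx (free t (α t)).dx).im) t := by
  refine (hasDerivAt_norm_sq_of_inner (𝕜 := ℂ)
    ((dxL.restrictScalars ℝ).hasFDerivAt.comp_hasDerivAt t hα)).congr_deriv ?_
  change 2 * (inner ℂ (nlsField G t (α t)).dx (α t).dx).re = _
  have hinner : inner ℂ (nlsField G t (α t)).dx (α t).dx
      = -(Complex.I * G t) * inner ℂ (cubic (free t (α t))).dx (free t (α t)).dx := by
    rw [← (freeL2 t).inner_map_map, ← dx_free, ← dx_free, free_nlsField, dx_smul, inner_smul_left,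
      map_mul, Complex.conj_I, Complex.conj_ofReal, neg_mul]
  rw [hinner]
  simp only [Complex.mul_re, Complex.mul_im, Complex.neg_re, Complex.neg_im, Complex.I_re,
    Complex.I_im, Complex.ofReal_re, Complex.ofReal_im]
  ring

theorem hasDerivAt_nlsEnergy {G' : ℝ} (hG : HasDerivAt G G' t)
    (hα : HasDerivAt α (nlsField G t (α t)) t) :
    HasDerivAt (fun s => nlsEnergy (G s) (free s (α s)))
      (-(G' / 4) * quartic (free t (α t))) t := by
  have hquartic := (hasWeakDerivAt_free_trajectory hα).quartic
    (continuousAt_free_trajectory hα.continuousAt)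
  rw [nlsRate_smul, map_ofNat, Complex.mul_re, Complex.re_ofNat, Complex.im_ofNat, zero_mul,
    sub_zero, nlsRate_cubic_re] at hquartic
  have hkinetic := (hasDerivAt_norm_dx_sq hα).div_const 2
  simp only [nlsEnergy, dx_free, LinearIsometry.norm_map]
  refine (hkinetic.sub ((hG.div_const 4).mul hquartic)).congr_deriv ?_
  rw [dx_free]
  ring

end Trajectory

section Bounds

variable {G G' : ℝ → ℝ} {α : ℝ → H1} {τ t : ℝ}

theorem norm_fn_eq_of_isIntegralCurveOn (hα : IsIntegralCurveOn α (nlsField G) (Set.Ioo (-τ) τ))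
    (ht : t ∈ Set.Ioo (-τ) τ) : ‖(α t).fn‖ = ‖(α 0).fn‖ := by
  have hderiv (s : ℝ) (hs : s ∈ Set.Ioo (-τ) τ) : HasDerivAt (fun s => ‖(α s).fn‖ ^ 2) 0 s :=
    hasDerivAt_norm_fn_sq ((hα s hs).hasDerivAt (isOpen_Ioo.mem_nhds hs))
  have hτ : 0 < τ := neg_lt_self_iff.1 (ht.1.trans ht.2)
  have hsq := isOpen_Ioo.is_const_of_deriv_eq_zero isPreconnected_Ioo
    (fun s hs => (hderiv s hs).differentiableAt.differentiableWithinAt)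
    (fun s hs => (hderiv s hs).deriv) ht ⟨neg_neg_of_pos hτ, hτ⟩
  exact (sq_eq_sq₀ (norm_nonneg _) (norm_nonneg _)).1 hsq

theorem norm_dx_le_of_isIntegralCurveOn {M₀ M₁ : ℝ} (hG : ∀ s, HasDerivAt G (G' s) s)
    (hM₀ : ∀ s ∈ Set.Ioo (-τ) τ, |G s| ≤ M₀) (hM₁ : ∀ s ∈ Set.Ioo (-τ) τ, |G' s| ≤ M₁)
    (hα : IsIntegralCurveOn α (nlsField G) (Set.Ioo (-τ) τ)) (ht : t ∈ Set.Ioo (-τ) τ) :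
    ‖(α t).dx‖ ≤ |nlsEnergy (G 0) (α 0) + ((M₀ * ‖(α 0).fn‖ ^ 3 / 2) ^ 2 + 1)| *
      Real.exp (M₁ * ‖(α 0).fn‖ ^ 3 / 2 * |t|) := by
  set m := ‖(α 0).fn‖
  set F : ℝ → ℝ := fun s =>
    nlsEnergy (G s) (free s (α s)) + ((M₀ * m ^ 3 / 2) ^ 2 + 1) with hF
  have hcoercive (s : ℝ) (hs : s ∈ Set.Ioo (-τ) τ) : ‖(α s).dx‖ ≤ |F s| := by
    have hle := norm_dx_le_nlsEnergy_add (hM₀ s hs) (free s (α s))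
    rw [fn_free, dx_free, LinearIsometry.norm_map, LinearIsometry.norm_map,
      norm_fn_eq_of_isIntegralCurveOn hα hs] at hle
    exact hle.trans (le_abs_self _)
  have hderiv (s : ℝ) (hs : s ∈ Set.Ioo (-τ) τ) :
      HasDerivAt F (-(G' s / 4) * quartic (free s (α s))) s :=
    (hasDerivAt_nlsEnergy (hG s) ((hα s hs).hasDerivAt (isOpen_Ioo.mem_nhds hs))).add_const _
  have hgrowth (s : ℝ) (hs : s ∈ Set.Ioo (-τ) τ) :
      ‖-(G' s / 4) * quartic (free s (α s))‖ ≤ M₁ * m ^ 3 / 2 * ‖F s‖ := by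
    have hM : 0 ≤ M₁ := (abs_nonneg _).trans (hM₁ s hs)
    have hquartic := abs_quartic_le (free s (α s))
    rw [fn_free, dx_free, LinearIsometry.norm_map, LinearIsometry.norm_map,
      norm_fn_eq_of_isIntegralCurveOn hα hs] at hquartic
    rw [norm_mul, norm_neg, norm_div, Real.norm_ofNat, Real.norm_eq_abs, Real.norm_eq_abs,
      Real.norm_eq_abs]
    calc |G' s| / 4 * |quartic (free s (α s))| ≤ M₁ / 4 * (2 * m ^ 3 * |F s|) := by
          gcongr
          · exact hM₁ s hs
          · exact hquartic.trans (by gcongr; exact hcoercive s hs)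
      _ = M₁ * m ^ 3 / 2 * |F s| := by ring
  have hgronwall := norm_le_mul_exp_of_norm_deriv_le hderiv hgrowth t ht
  simp only [hF, free_zero] at hgronwall
  exact (hcoercive t ht).trans hgronwall

theorem exists_norm_le_of_isIntegralCurveOn (hG : ∀ t, HasDerivAt G (G' t) t)
    (hG' : Continuous G') (f₀ : H1) (T : ℝ) :
    ∃ R : ℝ, ∀ τ ≤ T, ∀ α : ℝ → H1, α 0 = f₀ →
      IsIntegralCurveOn α (nlsField G) (Set.Ioo (-τ) τ) → ∀ t ∈ Set.Ioo (-τ) τ, ‖α t‖ ≤ R := by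
  have hGc : Continuous G := continuous_iff_continuousAt.2 fun t => (hG t).continuousAt
  obtain ⟨M₀, hM₀⟩ :=
    (isCompact_Icc (a := -T) (b := T)).exists_bound_of_continuousOn hGc.continuousOn
  obtain ⟨M₁, hM₁⟩ :=
    (isCompact_Icc (a := -T) (b := T)).exists_bound_of_continuousOn hG'.continuousOn
  refine ⟨‖f₀.fn‖ + |nlsEnergy (G 0) f₀ + ((M₀ * ‖f₀.fn‖ ^ 3 / 2) ^ 2 + 1)| *
      Real.exp (M₁ * ‖f₀.fn‖ ^ 3 / 2 * T), fun τ hτ α hα0 hα t ht => ?_⟩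
  have hsub : Set.Ioo (-τ) τ ⊆ Set.Icc (-T) T := fun s hs =>
    ⟨(neg_le_neg hτ).trans hs.1.le, hs.2.le.trans hτ⟩
  have hM₁0 : 0 ≤ M₁ := (norm_nonneg _).trans (hM₁ t (hsub ht))
  have htT : |t| ≤ T := abs_le.2 (hsub ht)
  refine (norm_le_add (α t)).trans (add_le_add ?_ ?_)
  · rw [norm_fn_eq_of_isIntegralCurveOn hα ht, hα0]
  · refine (norm_dx_le_of_isIntegralCurveOn hG (fun s hs => hM₀ s (hsub hs))
      (fun s hs => hM₁ s (hsub hs)) hα ht).trans ?_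
    rw [hα0]
    gcongr

end Bounds

theorem exists_continuous_hasWeakDerivAt_nlsRate {G G' : ℝ → ℝ} (hG : ∀ t, HasDerivAt G (G' t) t)
    (hG' : Continuous G') (f₀ : H1) :
    ∃ φ : ℝ → H1, Continuous φ ∧ (∀ t, ‖(φ t).fn‖ = ‖f₀.fn‖) ∧
      ∀ t, HasWeakDerivAt φ (nlsRate (G t) (φ t)) t := by
  have hGc : Continuous G := continuous_iff_continuousAt.2 fun t => (hG t).continuousAt
  obtain ⟨α, hα0, hα⟩ := (isLipschitzOnBalls_nlsField hGc).exists_isIntegralCurve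
    (exists_norm_le_of_isIntegralCurveOn hG hG' f₀)
  refine ⟨fun t => free t (α t), continuous_iff_continuousAt.2 fun t =>
    continuousAt_free_trajectory (hα t).continuousAt, fun t => ?_,
    fun t => hasWeakDerivAt_free_trajectory (hα t)⟩
  have hsq := apply_eq_apply_zero_of_hasDerivAt_zero (fun s => hasDerivAt_norm_fn_sq (hα s)) t
  rw [fn_free, LinearIsometry.norm_map, ← hα0]
  exact (sq_eq_sq₀ (norm_nonneg _) (norm_nonneg _)).1 hsq

end H1

/-! ### Growing solutions at and above the symmetry-breaking threshold -/

theorem H1.exists_fn_ne_zero : ∃ f : H1, f.fn ≠ 0 := by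
  let χ : ContDiffBump (0 : ℝ) := default
  have hsupp : HasCompactSupport fun x => (χ x : ℂ) :=
    χ.hasCompactSupport.comp_left Complex.ofReal_zero
  have hsmooth : ContDiff ℝ (⊤ : ℕ∞) fun x => (χ x : ℂ) :=
    Complex.ofRealCLM.contDiff.comp χ.contDiff
  refine ⟨schwartzH1 (hsupp.toSchwartzMap hsmooth), fun hzero => ?_⟩
  have hχ : hsupp.toSchwartzMap hsmooth = 0 := SchwartzMap.injective_toLp 2 volume
    (Eq.trans hzero (map_zero (SchwartzMap.toLpCLM ℂ ℂ 2 volume)).symm)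
  have hχ0 : (χ (0 : ℝ) : ℂ) = 0 := DFunLike.congr_fun hχ (0 : ℝ)
  rw [χ.one_of_mem_closedBall (Metric.mem_closedBall_self χ.rIn_pos.le)] at hχ0
  exact one_ne_zero (Complex.ofReal_eq_zero.1 hχ0)

theorem integral_manakov_smul (g : ℝ) (a b c : ℂ) (f w : H1) :
    ∫ x : ℝ, ((g * ‖(a • f).fn x‖ ^ 2 + g * ‖(b • f).fn x‖ ^ 2 : ℝ) : ℂ)
        * (c • f).fn x * conj (w.fn x)
      = c * (g * (‖a‖ ^ 2 + ‖b‖ ^ 2) : ℝ) * inner ℂ w.fn f.cubic.fn := by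
  rw [H1.inner_fn_cubic, potentialForm, ← integral_const_mul]
  refine integral_congr_ae ?_
  filter_upwards [H1.coeFn_smul a f, H1.coeFn_smul b f, H1.coeFn_smul c f] with x ha hb hc
  rw [ha, hb, hc, norm_mul, norm_mul]
  push_cast
  ring

/-- `(a, b)` solves the system `i a' = κ b + i γ a`, `i b' = κ a - i γ b`, the `x`-independent
linear part of the Manakov system. -/
structure IsLinearSolution (κ γ : ℝ) (a b : ℝ → ℂ) : Prop where
  hasDerivAt_fst : ∀ t, HasDerivAt a (-Complex.I * κ * b t + γ * a t) t
  hasDerivAt_snd : ∀ t, HasDerivAt b (-Complex.I * κ * a t - γ * b t) t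

namespace IsLinearSolution

variable {κ γ g : ℝ} {a b : ℝ → ℂ} {φ : ℝ → H1}

theorem continuous_fst (h : IsLinearSolution κ γ a b) : Continuous a :=
  continuous_iff_continuousAt.2 fun t => (h.hasDerivAt_fst t).continuousAt

theorem continuous_snd (h : IsLinearSolution κ γ a b) : Continuous b :=
  continuous_iff_continuousAt.2 fun t => (h.hasDerivAt_snd t).continuousAt

-- As `g₁₁ = g₁₂ = g₂₂`, the nonlinearity acts on both components as the same scalar potential, so
-- it commutes with the coupling by `κ` and `γ`.
theorem isGlobalSolution_smul (h : IsLinearSolution κ γ a b) (hφ : Continuous φ)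
    (hrate : ∀ t, HasWeakDerivAt φ (H1.nlsRate (g * (‖a t‖ ^ 2 + ‖b t‖ ^ 2)) (φ t)) t) :
    IsGlobalSolution g g g κ γ (fun t => a t • φ t) (fun t => b t • φ t) where
  continuous_u := h.continuous_fst.smul hφ
  continuous_v := h.continuous_snd.smul hφ
  eq_u t w := by
    rw [integral_manakov_smul]
    simp only [H1.fn_smul, H1.dx_smul, inner_smul_right]
    refine (((h.hasDerivAt_fst t).mul (hrate t w)).const_mul Complex.I).congr_deriv ?_
    rw [H1.nlsRate]
    linear_combination (-κ * b t * inner ℂ w.fn (φ t).fn - a t * inner ℂ w.dx (φ t).dx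
      + a t * (g * (‖a t‖ ^ 2 + ‖b t‖ ^ 2) : ℝ) * inner ℂ w.fn (φ t).cubic.fn) * Complex.I_sq
  eq_v t w := by
    rw [integral_manakov_smul]
    simp only [H1.fn_smul, H1.dx_smul, inner_smul_right]
    refine (((h.hasDerivAt_snd t).mul (hrate t w)).const_mul Complex.I).congr_deriv ?_
    rw [H1.nlsRate]
    linear_combination (-κ * a t * inner ℂ w.fn (φ t).fn - b t * inner ℂ w.dx (φ t).dx
      + b t * (g * (‖a t‖ ^ 2 + ‖b t‖ ^ 2) : ℝ) * inner ℂ w.fn (φ t).cubic.fn) * Complex.I_sq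

theorem exists_isGlobalSolution (h : IsLinearSolution κ γ a b) (g : ℝ) (f₀ : H1) :
    ∃ u v : ℝ → H1, IsGlobalSolution g g g κ γ u v ∧
      ∀ t, totalPower (u t) (v t) = (‖a t‖ ^ 2 + ‖b t‖ ^ 2) * ‖f₀.fn‖ ^ 2 := by
  have ha := h.continuous_fst
  have hb := h.continuous_snd
  obtain ⟨φ, hφ, hmass, hrate⟩ := H1.exists_continuous_hasWeakDerivAt_nlsRate
    (fun t => ((h.hasDerivAt_fst t).norm_sq.add (h.hasDerivAt_snd t).norm_sq).const_mul g)
    (by fun_prop) f₀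
  refine ⟨_, _, h.isGlobalSolution_smul hφ hrate, fun t => ?_⟩
  rw [totalPower, H1.fn_smul, H1.fn_smul, norm_smul, norm_smul, hmass]
  ring

end IsLinearSolution

theorem exists_second_deriv_eq_mul_self_ge {m : ℝ} (hm : 0 ≤ m) :
    ∃ c s : ℝ → ℝ, (∀ t, HasDerivAt s (c t) t) ∧ (∀ t, HasDerivAt c (m * s t) t) ∧
      ∀ t, 0 ≤ t → t ≤ s t := by
  rcases hm.eq_or_lt with rfl | hpos
  · refine ⟨fun _ => 1, id, hasDerivAt_id, fun t => ?_, fun t _ => le_rfl⟩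
    simpa only [zero_mul] using hasDerivAt_const t (1 : ℝ)
  · have hμ : 0 < √m := Real.sqrt_pos.2 hpos
    have hlin (t : ℝ) : HasDerivAt (fun t => √m * t) √m t := hasDerivAt_const_mul √m
    refine ⟨fun t => Real.cosh (√m * t), fun t => Real.sinh (√m * t) / √m, fun t => ?_,
      fun t => ?_, fun t ht => ?_⟩
    · exact ((hlin t).sinh.div_const √m).congr_deriv (mul_div_cancel_right₀ _ hμ.ne')
    · refine (hlin t).cosh.congr_deriv ?_
      rw [mul_div_left_comm, Real.div_sqrt]
    · rw [le_div_iff₀ hμ, mul_comm]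
      exact Real.self_le_sinh_iff.2 (by positivity)

theorem isLinearSolution_of_hasDerivAt {κ γ : ℝ} {c s : ℝ → ℝ} (hs : ∀ t, HasDerivAt s (c t) t)
    (hc : ∀ t, HasDerivAt c ((γ ^ 2 - κ ^ 2) * s t) t) :
    IsLinearSolution κ γ (fun t => c t + (γ - κ * Complex.I) * s t)
      (fun t => c t - (γ + κ * Complex.I) * s t) where
  hasDerivAt_fst t := by
    refine ((hc t).ofReal_comp.add ((hs t).ofReal_comp.const_mul _)).congr_deriv ?_
    push_cast
    linear_combination (-κ ^ 2 * s t : ℂ) * Complex.I_sq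
  hasDerivAt_snd t := by
    refine ((hc t).ofReal_comp.sub ((hs t).ofReal_comp.const_mul _)).congr_deriv ?_
    push_cast
    linear_combination (-κ ^ 2 * s t : ℂ) * Complex.I_sq

theorem exists_isLinearSolution_tendsto_atTop {κ γ : ℝ} (hle : |κ| ≤ |γ|) (hγ : γ ≠ 0) :
    ∃ a b : ℝ → ℂ, IsLinearSolution κ γ a b ∧
      Tendsto (fun t => ‖a t‖ ^ 2 + ‖b t‖ ^ 2) atTop atTop := by
  obtain ⟨c, s, hs, hc, hself⟩ := exists_second_deriv_eq_mul_self_ge (sub_nonneg.2 (sq_le_sq.2 hle))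
  refine ⟨_, _, isLinearSolution_of_hasDerivAt hs hc, ?_⟩
  refine tendsto_atTop_mono' atTop ?_
    ((tendsto_pow_atTop two_ne_zero).const_mul_atTop (show 0 < γ ^ 2 by positivity))
  filter_upwards [eventually_ge_atTop 0] with t ht
  have hpower : ‖(c t + (γ - κ * Complex.I) * s t : ℂ)‖ ^ 2
      + ‖(c t - (γ + κ * Complex.I) * s t : ℂ)‖ ^ 2
      = 2 * c t ^ 2 + 2 * (γ ^ 2 + κ ^ 2) * s t ^ 2 := by
    simp only [Complex.sq_norm, Complex.normSq_apply, Complex.add_re, Complex.add_im,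
      Complex.sub_re, Complex.sub_im, Complex.mul_re, Complex.mul_im, Complex.ofReal_re,
      Complex.ofReal_im, Complex.I_re, Complex.I_im]
    ring
  have hsq : γ ^ 2 * t ^ 2 ≤ γ ^ 2 * s t ^ 2 := by gcongr; exact hself t ht
  rw [hpower]
  nlinarith [sq_nonneg (c t), sq_nonneg (γ * s t), sq_nonneg (κ * s t)]

theorem theorem2_general (g κ γ : ℝ) :
    (|γ| < |κ| → ∀ u v : ℝ → H1, IsGlobalSolution g g g κ γ u v →
      (∃ Q : ℝ, 0 < Q ∧ ∀ t : ℝ, totalPower (u t) (v t) ≤ Q) ∧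
      (∀ t : ℝ, totalPower (u t) (v t) ≤ Qmax κ γ (u 0) (v 0))) ∧
    (|κ| ≤ |γ| → γ ≠ 0 → ∃ u v : ℝ → H1, IsGlobalSolution g g g κ γ u v ∧
      Tendsto (fun t : ℝ => totalPower (u t) (v t)) atTop atTop) := by
  refine ⟨fun hlt u v h => ?_, fun hle hγ => ?_⟩
  · have hQmax := h.totalPower_le_Qmax hlt
    exact ⟨⟨max 1 (Qmax κ γ (u 0) (v 0)), lt_max_of_lt_left one_pos,
      fun t => (hQmax t).trans (le_max_right _ _)⟩, hQmax⟩
  · obtain ⟨f₀, hf₀⟩ := H1.exists_fn_ne_zero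
    obtain ⟨a, b, hab, hgrowth⟩ := exists_isLinearSolution_tendsto_atTop hle hγ
    obtain ⟨u, v, h, hpower⟩ := hab.exists_isGlobalSolution g f₀
    refine ⟨u, v, h, ?_⟩
    simp only [hpower]
    exact hgrowth.atTop_mul_const (by positivity)

theorem theorem2 (g₁₁ g₁₂ g₂₂ κ γ : ℝ) (hg₁ : g₁₁ = g₂₂) (hg₂ : g₂₂ = g₁₂)
    (hκ : 0 ≤ κ) (hγ : 0 ≤ γ) :
    (γ < κ → ∀ u v : ℝ → H1, IsGlobalSolution g₁₁ g₁₂ g₂₂ κ γ u v →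
      (∃ Q : ℝ, 0 < Q ∧ ∀ t : ℝ, totalPower (u t) (v t) ≤ Q) ∧
      (∀ t : ℝ, totalPower (u t) (v t) ≤ Qmax κ γ (u 0) (v 0))) ∧
    (κ ≤ γ → 0 < γ → ∃ u v : ℝ → H1, IsGlobalSolution g₁₁ g₁₂ g₂₂ κ γ u v ∧
      Tendsto (fun t : ℝ => totalPower (u t) (v t)) atTop atTop) := by
  subst hg₁ hg₂
  simpa only [abs_of_nonneg hκ, abs_of_nonneg hγ, hγ.lt_iff_ne'] using theorem2_general g₁₁ κ γ
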